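/- Let $l,T,K_\alpha>0$, $0<\alpha<1$ and $\rho\in\mathbb C$ with $\Re(\rho)>0$; take $U(x)\equiv 1$. For $\nu>0$ put ${}^sI_t^{\nu}g(t)=\frac1{\Gamma(\nu)}\int_0^t(t-s)^{\nu-1}e^{-\rho(t-s)}g(s)\,ds$, let ${}^sD_t^{\alpha}g=\left(\frac{\partial}{\partial t}+\rho\right){}^sI_t^{1-\alpha}g$, and let ${}^s_cD_t^{\alpha}g={}^sD_t^{\alpha}\big[g(t)-e^{-\rho t}g(0)\big]$ (time derivatives are taken within $[0,T]$). Let $P:[0,l]\times[0,T]\to\mathbb C$ solve $$ {}^s_cD_t^{\alpha}P(x,t)=K_\alpha\,\partial_x^2P(x,t)+f(x,t),\qquad 0<x<l,\ 0<t\le T,$$ $$P(x,0)=\varphi(x)\ (0<x<l),\qquad P(0,t)=\psi_1(t),\quad P(l,t)=\psi_2(t)\ (0<t\le T),$$ where $f(\cdot,t)$, for each $t\in(0,T]$, and $\varphi$ are continuous on $[0,l]$. Assume $P\in C^{6,2}_{x,t}([0,l]\times[0,T])$, that is, the partial derivatives of $P$ of order at most $6$ in $x$ and those of order at most $2$ in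 $t$ exist and are continuous on $[0,l]\times[0,T]$. For positive integers $M,N$ let $h=l/M$, $\tau=T/N$, $x_i=ih$, $t_n=n\tau$. Let $l_k=(-1)^k\binom{\alpha}{k}$ and $d_k=e^{-\rho k\tau}l_k$. For a grid function $u=(u_0,\dots,u_M)$ and $1\le i\le M-1$ let $\delta_x^2u_i=(u_{i+1}-2u_i+u_{i-1})/h^2$ and $\mathcal H_hu_i=\frac1{12}(u_{i+1}+10u_i+u_{i-1})$, and let $\|u\|_\infty=\max_{1\le i\le M-1}|u_i|$ (which is $0$ if $M=1$). Let $(P_i^n)_{0\le i\le M,\,0\le n\le N}$ be a solution of the compact scheme that is of first order in time ($q=1$): $$\mathcal H_h\sum_{k=0}^{n}d_kP_i^{n-k}-\mathcal H_h\sum_{k=0}^{n}d_ke^{-\rho(n-k)\tau}P_i^0=K_\alpha\tau^\alpha\delta_x^2P_i^n+\tau^\alpha\mathcal H_hf(x_i,t_n),\qquad 1\le i\le M-1,\ 1\le n\le N,$$ $$P_i^0=\varphi(x_i)\ (0\le i\le M),\qquad P_0^n=\psi_1(t_n),\quad P_M^n=\psi_2(t_n)\ (1\le n\le N).$$ Then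 there is a constant $C>0$, independent of $M$ and $N$ (that is, of $h$ and $\tau$), of the scheme solution $(P_i^n)$ and of $n$, such that the error $E_i^n=P(x_i,t_n)-P_i^n$ satisfies $$\|E^n\|_\infty\le C(\tau+h^4),\qquad 0\le n\le N.$$ -/

import Mathlib

open Set

namespace FeynmanKac

/-! ### Fractional substantial calculus

`ρ` is the complex parameter and `u = U x` is the (real) value of the prescribed function at the
fixed space point.  Time functions live on the closed interval `[0, T]`; the time derivative is the
derivative within this interval (one-sided at the end points). -/

/-- Fractional substantial integral of order `ν > 0`:
`(1 / Γ(ν)) ∫₀ᵗ (t - s)^(ν - 1) e^{-ρ u (t - s)} g(s) ds`. -/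
noncomputable def substInt (ν : ℝ) (ρ : ℂ) (u : ℝ) (g : ℝ → ℂ) (t : ℝ) : ℂ :=
  (1 / (Real.Gamma ν : ℂ)) *
    ∫ s in (0 : ℝ)..t, (((t - s) ^ (ν - 1) : ℝ) : ℂ) * Complex.exp (-ρ * u * (t - s)) * g s

/-- The first order operator `∂/∂t + ρ u` on `[0, T]`. -/
noncomputable def substOp (T : ℝ) (ρ : ℂ) (u : ℝ) (g : ℝ → ℂ) (t : ℝ) : ℂ :=
  derivWithin g (Icc 0 T) t + ρ * u * g t

/-- Fractional substantial derivative of order `μ > 0`: with `m` the smallest integer that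
exceeds `μ`, it is `(∂/∂t + ρ u)^m` applied to the substantial integral of order `m - μ`. -/
noncomputable def substDeriv (T μ : ℝ) (ρ : ℂ) (u : ℝ) (g : ℝ → ℂ) : ℝ → ℂ :=
  (substOp T ρ u)^[⌊μ⌋₊ + 1] (substInt ((⌊μ⌋₊ + 1 : ℕ) - μ) ρ u g)

/-- Caputo fractional substantial derivative of order `α`: the substantial derivative of
`g(t) - e^{-ρ u t} g(0)`. -/
noncomputable def caputoSubst (T α : ℝ) (ρ : ℂ) (u : ℝ) (g : ℝ → ℂ) : ℝ → ℂ :=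
  substDeriv T α ρ u (fun t => g t - Complex.exp (-ρ * u * t) * g 0)

/-! ### The continuous problem -/

/-- `P ∈ C^{m,n}_{x,t}([0,l] × [0,T])`: the partial derivatives of order at most `m` in `x` and
those of order at most `n` in `t` exist and are jointly continuous on the closed rectangle
(one-sided derivatives at the ends). Nothing is asked of mixed derivatives. -/
structure IsCxt (m n : ℕ) (l T : ℝ) (P : ℝ → ℝ → ℂ) : Prop where
  contDiff_x : ∀ t ∈ Icc 0 T, ContDiffOn ℝ m (fun x => P x t) (Icc 0 l)
  contDiff_t : ∀ x ∈ Icc 0 l, ContDiffOn ℝ n (fun t => P x t) (Icc 0 T)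
  continuous_x : ∀ j ≤ m, ContinuousOn
    (fun p : ℝ × ℝ => iteratedDerivWithin j (fun x => P x p.2) (Icc 0 l) p.1) (Icc 0 l ×ˢ Icc 0 T)
  continuous_t : ∀ j ≤ n, ContinuousOn
    (fun p : ℝ × ℝ => iteratedDerivWithin j (fun t => P p.1 t) (Icc 0 T) p.2) (Icc 0 l ×ˢ Icc 0 T)

/-- `P` solves the backward fractional Feynman-Kac equation with source `f` on `(0,l) × (0,T]`,
with initial value `φ` and boundary values `ψ₁`, `ψ₂`. -/
structure IsSolution (l T K α : ℝ) (ρ : ℂ) (U : ℝ → ℝ) (f : ℝ → ℝ → ℂ) (φ ψ₁ ψ₂ : ℝ → ℂ)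
    (P : ℝ → ℝ → ℂ) : Prop where
  equation : ∀ x ∈ Ioo 0 l, ∀ t ∈ Ioc 0 T,
    caputoSubst T α ρ (U x) (P x) t
      = K * iteratedDerivWithin 2 (fun y => P y t) (Icc 0 l) x + f x t
  initial : ∀ x ∈ Ioo 0 l, P x 0 = φ x
  boundary_left : ∀ t ∈ Ioc 0 T, P 0 t = ψ₁ t
  boundary_right : ∀ t ∈ Ioc 0 T, P l t = ψ₂ t

/-! ### The compact difference scheme, first order in time

A grid function is a function `ℕ → ℂ` of which only the values at `0, …, M` matter. -/

/-- The coefficients `l_k = (-1)^k (α choose k)` of `(1 - z)^α`. -/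
noncomputable def coeff (α : ℝ) (k : ℕ) : ℝ := (-1) ^ k * Ring.choose α k

/-- `d_{i,k} = e^{-ρ U_i k τ} l_k`, with `u = U_i`. -/
noncomputable def substCoeff (α : ℝ) (ρ : ℂ) (u τ : ℝ) (k : ℕ) : ℂ :=
  Complex.exp (-ρ * u * (k * τ)) * coeff α k

/-- The difference quotient `δₓ u_{i+1/2} = (u_{i+1} - u_i) / h`. -/
noncomputable def diffHalf (h : ℝ) (u : ℕ → ℂ) (i : ℕ) : ℂ := (u (i + 1) - u i) / h

/-- `δₓ² u_i = (δₓ u_{i+1/2} - δₓ u_{i-1/2}) / h`, used for `1 ≤ i ≤ M - 1`. -/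
noncomputable def secondDiff (h : ℝ) (u : ℕ → ℂ) (i : ℕ) : ℂ :=
  (diffHalf h u i - diffHalf h u (i - 1)) / h

/-- The compact averaging operator `𝓗_h` on the grid `0, …, M`. -/
noncomputable def compactOp (M : ℕ) (u : ℕ → ℂ) (i : ℕ) : ℂ :=
  if 1 ≤ i ∧ i ≤ M - 1 then (u (i + 1) + 10 * u i + u (i - 1)) / 12 else u i

/-- The discrete maximum norm `max_{1 ≤ i ≤ M-1} |u_i|` (zero if there is no interior point). -/
noncomputable def maxNorm (M : ℕ) (u : ℕ → ℂ) : ℝ :=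
  ((Finset.Icc 1 (M - 1)).sup (fun i => ‖u i‖₊) : NNReal)

/-- `Q n i` (standing for `P_i^n`, `0 ≤ n ≤ N`, `0 ≤ i ≤ M`) solves the compact scheme with
`h = l / M`, `τ = T / N`. The initial layer contains the two corner values `P_0^0`, `P_M^0`. -/
structure IsSchemeSolution (l T K α : ℝ) (ρ : ℂ) (U : ℝ → ℝ) (f : ℝ → ℝ → ℂ) (φ ψ₁ ψ₂ : ℝ → ℂ)
    (M N : ℕ) (h τ : ℝ) (Q : ℕ → ℕ → ℂ) : Prop where
  equation : ∀ n ∈ Finset.Icc 1 N, ∀ i ∈ Finset.Icc 1 (M - 1),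
    compactOp M (fun j => ∑ k ∈ Finset.range (n + 1),
        substCoeff α ρ (U (j * h)) τ k * Q (n - k) j) i
      - compactOp M (fun j => ∑ k ∈ Finset.range (n + 1),
        substCoeff α ρ (U (j * h)) τ k
          * Complex.exp (-ρ * U (j * h) * ((n - k : ℕ) * τ)) * Q 0 j) i
      = K * (τ ^ α : ℝ) * secondDiff h (Q n) i
        + (τ ^ α : ℝ) * compactOp M (fun j => f (j * h) (n * τ)) i
  initial : ∀ i ∈ Finset.Icc 0 M, Q 0 i = φ (i * h)
  boundary_left : ∀ n ∈ Finset.Icc 1 N, Q n 0 = ψ₁ (n * τ)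
  boundary_right : ∀ n ∈ Finset.Icc 1 N, Q n M = ψ₂ (n * τ)

end FeynmanKac

namespace FeynmanKac

/-! ### Coefficients of `(1 - z)^α` -/

/-! Multiplication by `e^{ρt}` removes `ρ`. With `G(x,t) = e^{ρt} P(x,t) - P(x,0)` the Caputo
substantial derivative becomes `e^{-ρt}` times the fractional integral of order `1 - α` of `∂G/∂t`
(`caputoSubst_eq`), and the complex weights `d_k` become the real Grünwald weights `l_k`
(`conj_memory_sum`). Since `Re ρ > 0`, a bound for `e^{ρ t_n} E^n` also bounds `E^n`.

Consistency: `∂G/∂t` need not vanish at `t = 0`, so in the form multiplied by `τ^α` the time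
residual is only `O(τ n^(-α))` (`grunwald_truncation`). The space residual is `O(τ^α h^4)`
(`compact_truncation`), and `τ^α ≤ T^α n^(-α)`. The whole residual is therefore `O(n^(-α) (τ +
h^4))`. The partial sums `A_n = l_0 + ... + l_n` are bounded below by a multiple of `n^(-α)`
(`le_coeffSum`), so the residual is at most `A_n Y` with `Y = O(τ + h^4)`.

Stability: residuals bounded by `A_n Y` produce errors `O(Y)` in the maximum norm with no mesh
restriction (`grid_stability`). The maximum principle is unavailable for small `δ = K τ^α / h²`,
because the averaging operator then makes the off-diagonal entries positive. Instead, odd periodic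
extension moves the problem to the integers, where the operators become multipliers: `w = 1 - s/12`
for averaging and `w + δ s` for the implicit operator, with `s = 2 - 2 cos x`. The kernels with
symbol `w^m / (w + δ s)^(m+1)` have `ℓ¹` norms bounded by one constant for all `δ ≥ 0` and all `m`
(`resKernel_summable`). An induction on `n` bounds `(w/(w + δ s))^m ε_n` for every `m` at once: each
memory step raises `m` by one, the memory weights are nonnegative with sum `1 - A_n`, and the
residual contributes the missing share `A_n`. Taking `m = 0` gives the bound for `ε_n`. -/

theorem ringChoose_succ_mul (α : ℝ) (k : ℕ) :
    Ring.choose α (k + 1) * (k + 1) = Ring.choose α k * (α - k) := by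
  rw [Ring.choose_eq_smul, Ring.choose_eq_smul, descPochhammer_succ_right,
    Polynomial.smeval_mul, Nat.factorial_succ]
  have hk : ((k : ℝ) + 1) ≠ 0 := by positivity
  have hf : ((k.factorial : ℕ) : ℝ) ≠ 0 := by positivity
  simp only [Polynomial.smeval_sub, Polynomial.smeval_X, Polynomial.smeval_natCast, pow_one,
    pow_zero, smul_eq_mul, nsmul_eq_mul, mul_one]
  push_cast
  field_simp

theorem coeff_zero (α : ℝ) : coeff α 0 = 1 := by
  simp [coeff]

theorem coeff_succ_mul (α : ℝ) (k : ℕ) : coeff α (k + 1) * (k + 1) = coeff α k * (k - α) := by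
  unfold coeff
  have := ringChoose_succ_mul α k
  rw [mul_assoc, this, pow_succ]
  ring

/-- The partial sums of the coefficients of `(1 - z)^α`. -/
noncomputable def coeffSum (α : ℝ) (n : ℕ) : ℝ := ∑ k ∈ Finset.range (n + 1), coeff α k

theorem coeffSum_zero (α : ℝ) : coeffSum α 0 = 1 := by
  simp [coeffSum, coeff_zero]

theorem coeffSum_succ (α : ℝ) (n : ℕ) : coeffSum α (n + 1) = coeffSum α n + coeff α (n + 1) := by
  unfold coeffSum
  rw [Finset.sum_range_succ]

/-- This ties the sign of each weight to the positivity of the partial sums: for `0 < α < 1` every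
weight after the first is nonpositive. -/
theorem coeff_succ (α : ℝ) (k : ℕ) : coeff α (k + 1) = -α / (k + 1) * coeffSum α k := by
  induction k with
  | zero =>
    have := coeff_succ_mul α 0
    rw [coeff_zero] at this
    rw [coeffSum_zero]
    push_cast at this ⊢
    linarith
  | succ k ih =>
    have h := coeff_succ_mul α (k + 1)
    rw [coeffSum_succ]
    have hk : ((k : ℝ) + 1) ≠ 0 := by positivity
    have hk2 : ((k : ℝ) + 1 + 1) ≠ 0 := by positivity
    rw [ih] at h ⊢
    push_cast at h ⊢
    rw [← eq_div_iff hk2] at h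
    rw [h]
    field_simp
    ring

theorem coeffSum_succ_mul (α : ℝ) (n : ℕ) :
    coeffSum α (n + 1) = coeffSum α n * ((n + 1 - α) / (n + 1)) := by
  rw [coeffSum_succ, coeff_succ]
  have hk : ((n : ℝ) + 1) ≠ 0 := by positivity
  field_simp
  ring

theorem coeffSum_pos {α : ℝ} (h1 : α < 1) (n : ℕ) : 0 < coeffSum α n := by
  induction n with
  | zero => simp [coeffSum_zero]
  | succ n ih =>
    rw [coeffSum_succ_mul]
    have : (0 : ℝ) ≤ n := by positivity
    have : 0 < (n : ℝ) + 1 - α := by linarith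
    positivity

theorem coeff_succ_nonpos {α : ℝ} (h0 : 0 < α) (h1 : α < 1) (k : ℕ) : coeff α (k + 1) ≤ 0 := by
  rw [coeff_succ]
  have := coeffSum_pos h1 k
  rw [neg_div, neg_mul]
  have : 0 ≤ α / (k + 1) * coeffSum α k := by positivity
  linarith

/-- The partial sums are the coefficients of `(1 - z)^(α-1)`; summing once more gives those of `(1 -
z)^(α-2)`, which are again explicit. -/
theorem sum_coeffSum (α : ℝ) (h1 : α < 1) (n : ℕ) :
    ∑ j ∈ Finset.range n, coeffSum α j = n * coeffSum α n / (1 - α) := by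
  have : (1 - α) ≠ 0 := by linarith
  induction n with
  | zero => simp
  | succ n ih =>
    rw [Finset.sum_range_succ, ih, coeffSum_succ_mul]
    have hk : ((n : ℝ) + 1) ≠ 0 := by positivity
    push_cast
    field_simp
    ring

/-! ### Size of the partial sums, by Gamma function estimates -/

theorem coeffSum_mul_Gamma {α : ℝ} (h1 : α < 1) (n : ℕ) :
    coeffSum α n * Real.Gamma (1 - α) = Real.Gamma (n + 1 - α) / Real.Gamma (n + 1) := by
  induction n with
  | zero => simp [coeffSum_zero]
  | succ n ih =>
    have hn : (0 : ℝ) ≤ n := by positivity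
    have e1 : Real.Gamma (((n + 1 : ℕ) : ℝ) + 1 - α)
        = (n + 1 - α) * Real.Gamma (n + 1 - α) := by
      rw [← Real.Gamma_add_one (by linarith : (n : ℝ) + 1 - α ≠ 0)]
      push_cast
      congr 1
      ring
    have e2 : Real.Gamma (((n + 1 : ℕ) : ℝ) + 1) = (n + 1) * Real.Gamma (n + 1) := by
      rw [← Real.Gamma_add_one (by positivity : (n : ℝ) + 1 ≠ 0)]
      push_cast
      rfl
    rw [e1, e2, coeffSum_succ_mul, mul_right_comm, ih]
    have hk : ((n : ℝ) + 1) ≠ 0 := by positivity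
    have := (Real.Gamma_pos_of_pos (by positivity : (0 : ℝ) < n + 1)).ne'
    field_simp

/-- Log-convexity of Gamma at `n + 1 - α = α n + (1 - α)(n + 1)`. The companion lower bound
interpolates `n + 1` between `n + 1 - α` and `n + 2 - α`. -/
theorem coeffSum_mul_Gamma_le {α : ℝ} (h0 : 0 < α) (h1 : α < 1) {n : ℕ} (hn : 1 ≤ n) :
    coeffSum α n * Real.Gamma (1 - α) ≤ (n : ℝ) ^ (-α) := by
  rw [coeffSum_mul_Gamma h1]
  have hn0 : (0 : ℝ) < n := by exact_mod_cast hn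
  have key := Real.Gamma_mul_add_mul_le_rpow_Gamma_mul_rpow_Gamma (s := (n : ℝ)) (t := n + 1)
    (a := α) (b := 1 - α) hn0 (by linarith) h0 (by linarith) (by ring)
  have hg := Real.Gamma_pos_of_pos hn0
  rw [show α * (n : ℝ) + (1 - α) * (n + 1) = n + 1 - α by ring,
    Real.Gamma_add_one hn0.ne', Real.mul_rpow hn0.le hg.le, mul_left_comm, ← Real.rpow_add hg] at key
  rw [Real.Gamma_add_one hn0.ne', div_le_iff₀ (by positivity)]
  refine key.trans (le_of_eq ?_)
  rw [← mul_assoc, ← Real.rpow_add_one hn0.ne', show α + (1 - α) = 1 by ring, Real.rpow_one,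
    show -α + 1 = 1 - α by ring]

theorem le_coeffSum_mul_Gamma {α : ℝ} (h0 : 0 < α) (h1 : α < 1) (n : ℕ) :
    ((n : ℝ) + 1) ^ (-α) ≤ coeffSum α n * Real.Gamma (1 - α) := by
  rw [coeffSum_mul_Gamma h1]
  have hn0 : (0 : ℝ) ≤ n := by positivity
  have hx : 0 < (n : ℝ) + 1 - α := by linarith
  have key := Real.Gamma_mul_add_mul_le_rpow_Gamma_mul_rpow_Gamma (s := (n : ℝ) + 1 - α)
    (t := n + 1 - α + 1) (a := 1 - α) (b := α) hx (by linarith) (by linarith) h0 (by ring)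
  have hg := Real.Gamma_pos_of_pos hx
  rw [show (1 - α) * ((n : ℝ) + 1 - α) + α * (n + 1 - α + 1) = n + 1 by ring,
    Real.Gamma_add_one hx.ne', Real.mul_rpow hx.le hg.le, mul_left_comm, ← Real.rpow_add hg,
    show 1 - α + α = 1 by ring, Real.rpow_one] at key
  rw [le_div_iff₀ (Real.Gamma_pos_of_pos (by positivity))]
  have h2 : ((n : ℝ) + 1) ^ (-α) ≤ ((n : ℝ) + 1 - α) ^ (-α) :=
    Real.rpow_le_rpow_of_nonpos hx (by linarith) (by linarith)
  have h3 : ((n : ℝ) + 1 - α) ^ (-α) * ((n : ℝ) + 1 - α) ^ α = 1 := by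
    rw [← Real.rpow_add hx]
    simp
  calc ((n : ℝ) + 1) ^ (-α) * Real.Gamma (n + 1)
      ≤ ((n : ℝ) + 1 - α) ^ (-α) * (((n : ℝ) + 1 - α) ^ α * Real.Gamma (n + 1 - α)) := by
        gcongr
    _ = Real.Gamma (n + 1 - α) := by rw [← mul_assoc, h3, one_mul]

theorem rpow_neg_mul_le_add_one_rpow_neg {α : ℝ} (h0 : 0 < α) (h1 : α < 1) {n : ℕ} (hn : 1 ≤ n) :
    (n : ℝ) ^ (-α) * (1 - α / n) ≤ ((n : ℝ) + 1) ^ (-α) := by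
  have hn0 : (0 : ℝ) < n := by exact_mod_cast hn
  have e : ((n : ℝ) + 1) ^ (-α) = (n : ℝ) ^ (-α) * (1 + 1 / n) ^ (-α) := by
    rw [← Real.mul_rpow hn0.le (by positivity)]
    congr 1
    field_simp
  rw [e]
  refine mul_le_mul_of_nonneg_left ?_ (by positivity)
  rw [Real.rpow_neg (by positivity)]
  have h2 : (1 + 1 / (n : ℝ)) ^ α ≤ 1 + α * (1 / n) :=
    rpow_one_add_le_one_add_mul_self (by linarith [show (0 : ℝ) < 1 / n by positivity])
      h0.le h1.le
  have hp : 0 < (1 + 1 / (n : ℝ)) ^ α := by positivity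
  have hq : 0 < α / n := by positivity
  rw [← one_div, le_div_iff₀ hp]
  rcases le_or_gt (1 - α / n) 0 with h | h
  · nlinarith
  · rw [mul_one_div] at h2
    nlinarith

theorem le_coeffSum {α : ℝ} (h0 : 0 < α) (h1 : α < 1) {n : ℕ} (hn : 1 ≤ n) :
    (1 - α) / Real.Gamma (1 - α) * (n : ℝ) ^ (-α) ≤ coeffSum α n := by
  have hg := Real.Gamma_pos_of_pos (by linarith : 0 < 1 - α)
  rw [div_mul_eq_mul_div, div_le_iff₀ hg]
  refine le_trans ?_ (le_coeffSum_mul_Gamma h0 h1 n)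
  refine le_trans ?_ (rpow_neg_mul_le_add_one_rpow_neg h0 h1 hn)
  rw [mul_comm]
  refine mul_le_mul_of_nonneg_left ?_ (by positivity)
  have : α / n ≤ α := div_le_self h0.le (by exact_mod_cast hn)
  linarith

/-- The difference between the partial sums of the Grünwald weights and of the weights of the
exact integration of `u^(-α)`. -/
theorem abs_sum_coeffSum_sub_le {α : ℝ} (h0 : 0 < α) (h1 : α < 1) {n : ℕ} (hn : 1 ≤ n) :
    |∑ j ∈ Finset.range n, coeffSum α j - (n : ℝ) ^ (1 - α) / Real.Gamma (2 - α)|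
      ≤ 1 / Real.Gamma (2 - α) * (n : ℝ) ^ (-α) := by
  have hg := Real.Gamma_pos_of_pos (by linarith : 0 < 1 - α)
  have hn0 : (0 : ℝ) < n := by exact_mod_cast hn
  have h1' : 0 < 1 - α := by linarith
  have e : Real.Gamma (2 - α) = (1 - α) * Real.Gamma (1 - α) := by
    rw [← Real.Gamma_add_one (by linarith)]
    congr 1
    ring
  have e1 : (n : ℝ) ^ (1 - α) = n * (n : ℝ) ^ (-α) := by
    rw [sub_eq_add_neg, Real.rpow_add hn0, Real.rpow_one]
  have hu := coeffSum_mul_Gamma_le h0 h1 hn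
  have hl := (rpow_neg_mul_le_add_one_rpow_neg h0 h1 hn).trans (le_coeffSum_mul_Gamma h0 h1 n)
  have e2 : ∑ j ∈ Finset.range n, coeffSum α j - (n : ℝ) ^ (1 - α) / Real.Gamma (2 - α)
      = -(n * ((n : ℝ) ^ (-α) - coeffSum α n * Real.Gamma (1 - α)) / Real.Gamma (2 - α)) := by
    rw [sum_coeffSum α h1, e, e1]
    field_simp
    ring
  -- The two bounds for `A_n Γ(1 - α)` differ by the relative amount `α / n`, which cancels the
  -- factor `n`; hence the gap is at most `n^(-α)`.
  have hn' : 0 ≤ (n : ℝ) * ((n : ℝ) ^ (-α) - coeffSum α n * Real.Gamma (1 - α)) :=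
    mul_nonneg hn0.le (by linarith)
  have hn'' : (n : ℝ) * ((n : ℝ) ^ (-α) - coeffSum α n * Real.Gamma (1 - α))
      ≤ (n : ℝ) ^ (-α) := by
    have h3 : (n : ℝ) * ((n : ℝ) ^ (-α) * (1 - α / n)) = n * (n : ℝ) ^ (-α) - α * (n : ℝ) ^ (-α) := by
      field_simp
    have h4 := mul_le_mul_of_nonneg_left hl hn0.le
    have h5 : 0 ≤ (n : ℝ) ^ (-α) := by positivity
    nlinarith
  rw [e2, abs_neg, abs_of_nonneg (by rw [e]; positivity), div_mul_eq_mul_div, one_mul]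
  have : 0 < Real.Gamma (2 - α) := by rw [e]; positivity
  gcongr

theorem sum_rpow_neg_le {α : ℝ} (h0 : 0 < α) (h1 : α < 1) (n : ℕ) :
    ∑ m ∈ Finset.range n, ((m : ℝ) + 1) ^ (-α) ≤ (n : ℝ) ^ (1 - α) / (1 - α) := by
  induction n with
  | zero => simp [Real.zero_rpow (by linarith : 1 - α ≠ 0)]
  | succ n ih =>
    rw [Finset.sum_range_succ]
    have h1' : 0 < 1 - α := by linarith
    have hx : (0 : ℝ) < n + 1 := by positivity
    have hb : (1 + -(1 / ((n : ℝ) + 1))) ^ (1 - α) ≤ 1 + (1 - α) * (-(1 / ((n : ℝ) + 1))) :=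
      rpow_one_add_le_one_add_mul_self
        (by rw [neg_le_neg_iff, div_le_one hx]; linarith [show (0 : ℝ) ≤ n by positivity])
        h1'.le (by linarith)
    have e : (n : ℝ) ^ (1 - α) = ((n : ℝ) + 1) ^ (1 - α) * (1 + -(1 / ((n : ℝ) + 1))) ^ (1 - α) := by
      rw [← Real.mul_rpow hx.le]
      · congr 1
        field_simp
        ring
      · have : 1 / ((n : ℝ) + 1) ≤ 1 := by
          rw [div_le_one hx]; linarith [show (0 : ℝ) ≤ n by positivity]
        linarith
    have e2 : ((n : ℝ) + 1) ^ (-α) = ((n : ℝ) + 1) ^ (1 - α) * (1 / ((n : ℝ) + 1)) := by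
      rw [show 1 - α = -α + 1 by ring, Real.rpow_add_one hx.ne']
      field_simp
    have hp : 0 < ((n : ℝ) + 1) ^ (1 - α) := by positivity
    push_cast
    rw [le_div_iff₀ h1'] at ih ⊢
    have := mul_le_mul_of_nonneg_left hb hp.le
    rw [← e] at this
    rw [add_mul, e2]
    nlinarith

/-! ### Functions on the circle with absolutely summable Fourier coefficients -/

theorem neg_pi_lt_pi : -Real.pi < Real.pi := by linarith [Real.pi_pos]

/-- The Fourier coefficients of a function on `[-π, π]`. -/
noncomputable def fcoef (f : ℝ → ℂ) (j : ℤ) : ℂ := fourierCoeffOn neg_pi_lt_pi f j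

theorem fourier_two_pi (j : ℤ) (x : ℝ) :
    fourier j (x : AddCircle (Real.pi - -Real.pi)) = Complex.exp (j * x * Complex.I) := by
  rw [fourier_coe_apply]
  congr 1
  have : (Real.pi : ℂ) ≠ 0 := by exact_mod_cast Real.pi_ne_zero
  push_cast
  field_simp
  ring

theorem fcoef_eq_integral (f : ℝ → ℂ) (j : ℤ) :
    fcoef f j = (1 / (2 * Real.pi) : ℝ) •
      ∫ x in (-Real.pi)..Real.pi, Complex.exp (-(j * x * Complex.I)) * f x := by
  rw [fcoef, fourierCoeffOn_eq_integral]
  simp_rw [fourier_two_pi]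
  congr 1
  · ring
  · push_cast
    simp only [neg_mul, smul_eq_mul]

/-- Shifting the index by one multiplies the function by `e^{∓ix}`, so a symmetric tridiagonal
operator on the coefficients is multiplication by a cosine symbol. -/
theorem fcoef_tridiagonal {f : ℝ → ℂ} (hf : Continuous f) (c : ℂ) (j : ℤ) :
    (1 - 2 * c) * fcoef f j + c * (fcoef f (j + 1) + fcoef f (j - 1))
      = fcoef (fun x => (1 - c * (2 - 2 * Real.cos x : ℝ)) * f x) j := by
  simp only [fcoef_eq_integral, Complex.real_smul]
  have hi : ∀ k : ℤ, IntervalIntegrable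
      (fun x : ℝ => Complex.exp (-(k * x * Complex.I)) * f x) MeasureTheory.volume
      (-Real.pi) Real.pi := by
    intro k
    exact Continuous.intervalIntegrable (by fun_prop) _ _
  have e : ∀ x : ℝ, Complex.exp (-(j * x * Complex.I)) *
      ((1 - c * (2 - 2 * Real.cos x : ℝ)) * f x)
      = (1 - 2 * c) * (Complex.exp (-(j * x * Complex.I)) * f x)
        + c * (Complex.exp (-((j + 1 : ℤ) * x * Complex.I)) * f x
          + Complex.exp (-((j - 1 : ℤ) * x * Complex.I)) * f x) := by
    intro x
    have h1 : Complex.exp (-((j + 1 : ℤ) * x * Complex.I))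
        = Complex.exp (-(j * x * Complex.I)) * Complex.exp (-x * Complex.I) := by
      rw [← Complex.exp_add]
      congr 1
      push_cast
      ring
    have h2 : Complex.exp (-((j - 1 : ℤ) * x * Complex.I))
        = Complex.exp (-(j * x * Complex.I)) * Complex.exp (x * Complex.I) := by
      rw [← Complex.exp_add]
      congr 1
      push_cast
      ring
    rw [h1, h2]
    push_cast
    rw [Complex.cos]
    ring
  simp_rw [e]
  rw [intervalIntegral.integral_add ((hi j).const_mul _) (((hi _).add (hi _)).const_mul _),
    intervalIntegral.integral_const_mul, intervalIntegral.integral_const_mul,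
    intervalIntegral.integral_add (hi _) (hi _)]
  ring

theorem fcoef_one (j : ℤ) : fcoef (fun _ => 1) j = if j = 0 then 1 else 0 := by
  have hpi : (Real.pi : ℂ) ≠ 0 := by exact_mod_cast Real.pi_ne_zero
  split_ifs with h
  · subst h
    rw [fcoef_eq_integral]
    simp
    field_simp
    norm_num
  · unfold fcoef
    rw [fourierCoeffOn_of_hasDerivAt (f := fun _ => 1) (f' := fun _ => 0) neg_pi_lt_pi h
      (fun x _ => hasDerivAt_const x _) (by simp), fourierCoeffOn_eq_integral]
    simp

/-- The summand is dominated by the telescoping difference `4J²/(J+n) - 4J²/(J+n+1)`; the subtracted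
term on the right makes the induction close. -/
theorem sum_range_weight_le {J : ℕ} (hJ : 1 ≤ J) (n : ℕ) :
    ∑ j ∈ Finset.range n, 1 / (1 + ((j : ℝ) / (J : ℝ)) ^ 2) ≤ 4 * (J : ℝ) - 4 * (J : ℝ) ^ 2 / ((J : ℝ) + n) := by
  have hJ' : (1 : ℝ) ≤ J := by exact_mod_cast hJ
  induction n with
  | zero =>
    simp
    field_simp
    simp
  | succ n ih =>
    rw [Finset.sum_range_succ]
    have hn : (0 : ℝ) ≤ n := by positivity
    have e : 1 / (1 + ((n : ℝ) / (J : ℝ)) ^ 2) ≤ 4 * J ^ 2 / (J + n) - 4 * J ^ 2 / (J + n + 1) := by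
      have : (4 : ℝ) * J ^ 2 / (J + n) - 4 * J ^ 2 / (J + n + 1)
          = 4 * J ^ 2 / ((J + n) * (J + n + 1)) := by
        field_simp
        ring
      rw [this, show 1 / (1 + ((n : ℝ) / (J : ℝ)) ^ 2) = J ^ 2 / (J ^ 2 + n ^ 2) by field_simp]
      rw [div_le_div_iff₀ (by positivity) (by positivity)]
      have : ((J : ℝ) + n) * (J + n + 1) ≤ 4 * (J ^ 2 + n ^ 2) := by
        nlinarith [sq_nonneg ((J : ℝ) - n)]
      nlinarith [sq_nonneg (J : ℝ)]
    push_cast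
    rw [← add_assoc]
    linarith

theorem summable_weight {J : ℕ} (hJ : 1 ≤ J) :
    Summable (fun j : ℤ => 1 / (1 + ((j : ℝ) / (J : ℝ)) ^ 2)) ∧
      ∑' j : ℤ, 1 / (1 + ((j : ℝ) / (J : ℝ)) ^ 2) ≤ 8 * (J : ℝ) := by
  have hb : ∀ n : ℕ, ∑ j ∈ Finset.range n, 1 / (1 + ((j : ℝ) / (J : ℝ)) ^ 2) ≤ 4 * (J : ℝ) := by
    intro n
    have := sum_range_weight_le hJ n
    have h2 : (0 : ℝ) ≤ 4 * J ^ 2 / (J + n) := by positivity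
    linarith
  have hb' : ∀ n : ℕ, ∑ j ∈ Finset.range n, 1 / (1 + (((j : ℝ) + 1) / (J : ℝ)) ^ 2) ≤ 4 * (J : ℝ) := by
    intro n
    refine le_trans ?_ (hb n)
    refine Finset.sum_le_sum fun j _ => ?_
    gcongr
    linarith
  have s1 := summable_of_sum_range_le (fun n => by positivity) hb
  have s2 := summable_of_sum_range_le (fun n => by positivity) hb'
  have t1 := Real.tsum_le_of_sum_range_le (fun n => by positivity) hb
  have t2 := Real.tsum_le_of_sum_range_le (fun n => by positivity) hb'
  have key : HasSum (fun j : ℤ => 1 / (1 + ((j : ℝ) / (J : ℝ)) ^ 2))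
      (∑' j : ℕ, 1 / (1 + ((j : ℝ) / (J : ℝ)) ^ 2) + ∑' j : ℕ, 1 / (1 + (((j : ℝ) + 1) / (J : ℝ)) ^ 2)) := by
    refine HasSum.of_nat_of_neg_add_one ?_ ?_
    · simpa using s1.hasSum
    · convert! s2.hasSum using 2 with j
      push_cast
      rw [neg_div, neg_sq]
  refine ⟨key.summable, ?_⟩
  rw [key.tsum_eq]
  linarith

/-- A continuously differentiable periodic function whose `L²` norm and that of its derivative
are balanced at the frequency `J` has Fourier coefficients bounded in `ℓ¹` independently
of `J`. -/
theorem fcoef_summable_of_deriv {f f' : ℝ → ℂ} (hf : ∀ x, HasDerivAt f (f' x) x)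
    (hf' : Continuous f') (hper : f Real.pi = f (-Real.pi)) {J : ℕ} (hJ : 1 ≤ J) {D : ℝ}
    (h0 : ∫ x in (-Real.pi)..Real.pi, ‖f x‖ ^ 2 ≤ D / J)
    (h1 : ∫ x in (-Real.pi)..Real.pi, ‖f' x‖ ^ 2 ≤ D * J) :
    Summable (fun j => ‖fcoef f j‖) ∧ ∑' j, ‖fcoef f j‖ ≤ (8 + D / Real.pi) / 2 := by
  have hpi := Real.pi_pos
  have hJ' : (1 : ℝ) ≤ J := by exact_mod_cast hJ
  have hJ0 : (0 : ℝ) < J := by linarith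
  have hfc : Continuous f := continuous_iff_continuousAt.2 fun x => (hf x).continuousAt
  have hL : ∀ g : ℝ → ℂ, Continuous g →
      HasSum (fun i => ‖fcoef g i‖ ^ 2)
        ((2 * Real.pi)⁻¹ * ∫ x in (-Real.pi)..Real.pi, ‖g x‖ ^ 2) := by
    intro g hg
    have hm : MeasureTheory.MemLp g 2
        (MeasureTheory.volume.restrict (Ioc (-Real.pi) Real.pi)) := by
      rw [MeasureTheory.memLp_two_iff_integrable_sq_norm hg.aestronglyMeasurable]
      exact (Continuous.integrableOn_Icc (by fun_prop)).mono_set Ioc_subset_Icc_self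
    have := hasSum_sq_fourierCoeffOn neg_pi_lt_pi hm
    rw [smul_eq_mul, show Real.pi - -Real.pi = 2 * Real.pi by ring] at this
    exact this
  have hd : ∀ j : ℤ, ‖fcoef f' j‖ = |(j : ℝ)| * ‖fcoef f j‖ := by
    intro j
    rcases eq_or_ne j 0 with rfl | hj
    · have : fcoef f' 0 = 0 := by
        rw [fcoef_eq_integral]
        have e : ∫ x in (-Real.pi)..Real.pi, f' x = f Real.pi - f (-Real.pi) :=
          intervalIntegral.integral_eq_sub_of_hasDerivAt (fun x _ => hf x)
            (hf'.intervalIntegrable _ _)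
        simp [e, hper]
      simp [this]
    · have := fourierCoeffOn_of_hasDerivAt neg_pi_lt_pi hj (fun x _ => hf x)
        (hf'.intervalIntegrable _ _)
      unfold fcoef
      rw [this, hper, sub_self, mul_zero, zero_sub, norm_mul, norm_neg, norm_mul, norm_div]
      have hj' : |(j : ℝ)| ≠ 0 := by simpa using hj
      have e1 : ‖(Real.pi : ℂ) - (-Real.pi : ℝ)‖ = 2 * Real.pi := by
        rw [← Complex.ofReal_sub, Complex.norm_real, Real.norm_of_nonneg (by linarith)]
        ring
      rw [e1]
      simp only [norm_one, norm_mul, norm_neg, Complex.norm_I, Complex.norm_intCast,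
        Complex.norm_real, Complex.norm_two, Real.norm_of_nonneg hpi.le]
      field_simp
  have hs0 := hL f hfc
  have hs1 := hL f' hf'
  have hs : HasSum (fun j : ℤ => (1 + ((j : ℝ) / (J : ℝ)) ^ 2) * ‖fcoef f j‖ ^ 2)
      ((2 * Real.pi)⁻¹ * (∫ x in (-Real.pi)..Real.pi, ‖f x‖ ^ 2)
        + (1 / (J : ℝ) ^ 2) * ((2 * Real.pi)⁻¹ * ∫ x in (-Real.pi)..Real.pi, ‖f' x‖ ^ 2)) := by
    convert! hs0.add (hs1.mul_left (1 / (J : ℝ) ^ 2)) using 2 with j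
    rw [hd, mul_pow, sq_abs]
    field_simp
  have hbound : ((2 * Real.pi)⁻¹ * (∫ x in (-Real.pi)..Real.pi, ‖f x‖ ^ 2)
        + (1 / (J : ℝ) ^ 2) * ((2 * Real.pi)⁻¹ * ∫ x in (-Real.pi)..Real.pi, ‖f' x‖ ^ 2))
        ≤ D / Real.pi / J := by
    calc _ ≤ (2 * Real.pi)⁻¹ * (D / J) + (1 / (J : ℝ) ^ 2) * ((2 * Real.pi)⁻¹ * (D * J)) := by
          gcongr
      _ = _ := by field_simp; ring
  obtain ⟨hw, hw'⟩ := summable_weight hJ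
  -- Cauchy–Schwarz with weight `u = 1 + (j/J)²`, in its termwise arithmetic-geometric form `y ≤
  -- 1/(2Ju) + J u y²/2`. The first part sums to at most `4`, the second is controlled by Parseval
  -- for `f` and `f'`.
  have hle : ∀ j : ℤ, ‖fcoef f j‖ ≤ (1 / (2 * J)) * (1 / (1 + ((j : ℝ) / (J : ℝ)) ^ 2))
      + (J / 2) * ((1 + ((j : ℝ) / (J : ℝ)) ^ 2) * ‖fcoef f j‖ ^ 2) := by
    intro j
    set u := 1 + ((j : ℝ) / (J : ℝ)) ^ 2
    have hu : 0 < u := by positivity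
    set y := ‖fcoef f j‖
    have : (1 / (2 * J)) * (1 / u) + (J / 2) * (u * y ^ 2) - y
        = (J * u * y - 1) ^ 2 / (2 * J * u) := by
      field_simp
      ring
    have h3 : 0 ≤ (J * u * y - 1) ^ 2 / (2 * J * u) := by positivity
    linarith
  have hsum := (hw.mul_left (1 / (2 * (J : ℝ)))).add (hs.summable.mul_left ((J : ℝ) / 2))
  have hsf : Summable (fun j => ‖fcoef f j‖) :=
    Summable.of_nonneg_of_le (fun _ => norm_nonneg _) hle hsum
  refine ⟨hsf, (hsf.tsum_le_tsum hle hsum).trans ?_⟩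
  rw [(hw.mul_left _).tsum_add (hs.summable.mul_left _), tsum_mul_left, tsum_mul_left, hs.tsum_eq]
  calc _ ≤ 1 / (2 * (J : ℝ)) * (8 * J) + J / 2 * (D / Real.pi / J) := by gcongr
    _ = _ := by field_simp

/-! ### The symbols of the compact scheme -/

/-- The symbol of the second difference `2 u_j - u_{j+1} - u_{j-1}`. -/
noncomputable def symb (x : ℝ) : ℝ := 2 - 2 * Real.cos x

/-- The symbol `w^m / (w + δ s)^(m+1)`, with `s` the symbol of the second difference and `w` that
of the compact averaging operator. -/
noncomputable def resSymb (δ : ℝ) (m : ℕ) (x : ℝ) : ℝ :=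
  (1 - symb x / 12) ^ m / (1 - symb x / 12 + δ * symb x) ^ (m + 1)

theorem symb_nonneg (x : ℝ) : 0 ≤ symb x := by
  unfold symb
  linarith [Real.cos_le_one x]

theorem symb_le (x : ℝ) : symb x ≤ 4 := by
  unfold symb
  linarith [Real.neg_one_le_cos x]

theorem hasDerivAt_symb (x : ℝ) : HasDerivAt symb (2 * Real.sin x) x := by
  unfold symb
  convert! ((Real.hasDerivAt_cos x).const_mul 2).const_sub 2 using 1
  ring

theorem sq_sin_le_symb (x : ℝ) : (2 * Real.sin x) ^ 2 ≤ 4 * symb x := by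
  unfold symb
  have := Real.sin_sq_add_cos_sq x
  nlinarith [sq_nonneg (1 - Real.cos x)]

theorem continuous_symb : Continuous symb := by
  unfold symb
  fun_prop

theorem compactSymb_pos (x : ℝ) : 2 / 3 ≤ 1 - symb x / 12 := by
  linarith [symb_le x]

theorem resSymb_den_pos {δ : ℝ} (hδ : 0 ≤ δ) (x : ℝ) : 0 < 1 - symb x / 12 + δ * symb x := by
  have := mul_nonneg hδ (symb_nonneg x)
  linarith [compactSymb_pos x]

theorem continuous_resSymb {δ : ℝ} (hδ : 0 ≤ δ) (m : ℕ) : Continuous (resSymb δ m) := by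
  unfold resSymb
  have := continuous_symb
  exact Continuous.div (by fun_prop) (by fun_prop)
    fun x => pow_ne_zero _ (resSymb_den_pos hδ x).ne'

/-- The derivative of `resSymb`. -/
noncomputable def resSymbDeriv (δ : ℝ) (m : ℕ) (x : ℝ) : ℝ :=
  2 * Real.sin x * ((1 - symb x / 12) ^ m / (1 - symb x / 12 + δ * symb x) ^ (m + 1)
    * (1 / (12 * (1 - symb x / 12))
      - (m + 1) * δ / ((1 - symb x / 12) * (1 - symb x / 12 + δ * symb x))))

theorem hasDerivAt_resSymb {δ : ℝ} (hδ : 0 ≤ δ) (m : ℕ) (x : ℝ) :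
    HasDerivAt (resSymb δ m) (resSymbDeriv δ m x) x := by
  have hd := resSymb_den_pos hδ x
  have hw : 0 < 1 - symb x / 12 := by linarith [compactSymb_pos x]
  have h1 : HasDerivAt (fun x => 1 - symb x / 12) (-(2 * Real.sin x / 12)) x :=
    ((hasDerivAt_symb x).div_const 12).const_sub 1
  have h2 : HasDerivAt (fun x => 1 - symb x / 12 + δ * symb x)
      (-(2 * Real.sin x / 12) + δ * (2 * Real.sin x)) x :=
    h1.add ((hasDerivAt_symb x).const_mul δ)
  have h3 := (h1.fun_pow m).fun_div (h2.fun_pow (m + 1)) (pow_ne_zero _ hd.ne')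
  refine h3.congr_deriv ?_
  unfold resSymbDeriv
  set w := 1 - symb x / 12 with hwdef
  set d := w + δ * symb x with hddef
  have hs : symb x = 12 * (1 - w) := by rw [hwdef]; ring
  rw [hs] at hddef
  rcases m with _ | m
  · simp only [pow_zero, Nat.cast_zero, zero_mul, zero_add, pow_one]
    field_simp
    rw [hddef]
    ring
  · simp only [Nat.add_sub_cancel]
    field_simp
    rw [hddef]
    push_cast
    ring

theorem continuous_resSymbDeriv {δ : ℝ} (hδ : 0 ≤ δ) (m : ℕ) : Continuous (resSymbDeriv δ m) := by
  unfold resSymbDeriv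
  have := continuous_symb
  have hw : ∀ x, 0 < 1 - symb x / 12 := fun x => by linarith [compactSymb_pos x]
  have hd := resSymb_den_pos hδ
  refine Continuous.mul (by fun_prop) (Continuous.mul (Continuous.div (by fun_prop) (by fun_prop)
    fun x => pow_ne_zero _ (hd x).ne') (Continuous.sub (Continuous.div (by fun_prop) (by fun_prop)
    fun x => by have := hw x; positivity) (Continuous.div (by fun_prop) (by fun_prop)
    fun x => by have := hw x; have := hd x; positivity)))

/-- Since `w ≤ 1`, `w + δ s ≥ w (1 + δ s)`, and Bernoulli's inequality applies to `(1 + δ s)^p`.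
Thus `δ` and the power enter the decay only through their product. -/
theorem pow_div_pow_le {δ s w : ℝ} (hδ : 0 ≤ δ) (hs : 0 ≤ s) (hw : 0 < w) (hw1 : w ≤ 1) (p : ℕ) :
    w ^ p / (w + δ * s) ^ p ≤ 1 / (1 + p * δ * s) := by
  have hds : 0 ≤ δ * s := by positivity
  have hb := one_add_mul_le_pow (show (-2 : ℝ) ≤ δ * s by linarith) p
  have h1 : w * (1 + δ * s) ≤ w + δ * s := by nlinarith
  have h2 : w ^ p * (1 + δ * s) ^ p ≤ (w + δ * s) ^ p := by
    rw [← mul_pow]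
    gcongr
  rw [div_le_div_iff₀ (by positivity) (by positivity), one_mul]
  calc w ^ p * (1 + p * δ * s) ≤ w ^ p * (1 + δ * s) ^ p := by
        gcongr
        linarith
    _ ≤ _ := h2

theorem resSymb_le {δ : ℝ} (hδ : 0 ≤ δ) (m : ℕ) (x : ℝ) :
    0 ≤ resSymb δ m x ∧ resSymb δ m x ≤ 3 / 2 * (1 / (1 + (m + 1 : ℕ) * δ * symb x)) := by
  have hd := resSymb_den_pos hδ x
  have hw := compactSymb_pos x
  have hw0 : 0 < 1 - symb x / 12 := by linarith
  have hs := symb_nonneg x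
  have h := pow_div_pow_le hδ hs hw0 (by linarith) (m + 1)
  unfold resSymb
  refine ⟨by positivity, ?_⟩
  set w := 1 - symb x / 12
  calc w ^ m / (w + δ * symb x) ^ (m + 1)
      = (1 / w) * (w ^ (m + 1) / (w + δ * symb x) ^ (m + 1)) := by rw [pow_succ w m]; field_simp
    _ ≤ 3 / 2 * (1 / (1 + (m + 1 : ℕ) * δ * symb x)) := by
        refine mul_le_mul ?_ h (by positivity) (by norm_num)
        rw [div_le_iff₀ hw0]
        linarith

theorem abs_resSymbDeriv_le {δ : ℝ} (hδ : 0 ≤ δ) (m : ℕ) (x : ℝ) :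
    |resSymbDeriv δ m x| ≤ |2 * Real.sin x| *
      (4 * ((m + 1 : ℕ) * δ + 1) * (1 / (1 + (m + 1 : ℕ) * δ * symb x))) := by
  have hd := resSymb_den_pos hδ x
  have hw := compactSymb_pos x
  have hw0 : 0 < 1 - symb x / 12 := by linarith
  have hs := symb_nonneg x
  obtain ⟨h0, h1⟩ := resSymb_le hδ m x
  unfold resSymbDeriv
  rw [abs_mul]
  refine mul_le_mul_of_nonneg_left ?_ (abs_nonneg _)
  change |resSymb δ m x * _| ≤ _
  rw [abs_mul, abs_of_nonneg h0]
  set w := 1 - symb x / 12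
  have hwd : w ≤ w + δ * symb x := by linarith [mul_nonneg hδ hs]
  -- The bracket is the logarithmic derivative of the symbol with respect to `s`, up to sign. From
  -- `w ≥ 2/3` one has `1/(w (w + δ s)) ≤ 9/4 ≤ 8/3`.
  have h2 : |1 / (12 * w) - (m + 1) * δ / (w * (w + δ * symb x))|
      ≤ 8 / 3 * ((m + 1 : ℕ) * δ + 1) := by
    have a1 : 1 / (12 * w) ≤ 8 / 3 := by
      rw [div_le_iff₀ (by positivity)]
      linarith
    have a2 : (m + 1) * δ / (w * (w + δ * symb x)) ≤ (m + 1) * δ * (8 / 3) := by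
      rw [div_le_iff₀ (by positivity)]
      have : 1 ≤ 8 / 3 * (w * (w + δ * symb x)) := by nlinarith
      have h3 : 0 ≤ (m + 1) * δ := by positivity
      nlinarith
    have a3 : 0 ≤ 1 / (12 * w) := by positivity
    have a4 : 0 ≤ (m + 1) * δ / (w * (w + δ * symb x)) := by positivity
    push_cast
    rw [abs_le]
    constructor <;> nlinarith
  calc resSymb δ m x * |1 / (12 * w) - (m + 1) * δ / (w * (w + δ * symb x))|
      ≤ (3 / 2 * (1 / (1 + (m + 1 : ℕ) * δ * symb x))) * (8 / 3 * ((m + 1 : ℕ) * δ + 1)) := by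
        gcongr
    _ = _ := by ring

/-- On `[-π, π]` the symbol is at least `x²/4`. The constant is `129 = 1 + 8 · 16`, from `J² ≤ 2L +
8` and `x² ≤ 16`. -/
theorem inv_one_add_symb_le {L : ℝ} (hL : 0 ≤ L) {J : ℝ} (hJ : J ^ 2 ≤ 2 * L + 8) {x : ℝ}
    (hx : |x| ≤ Real.pi) : 1 / (1 + L * symb x) ≤ 129 * (1 + (J * x) ^ 2)⁻¹ := by
  have hs : x ^ 2 / 4 ≤ symb x := by
    have h := Real.cos_le_one_sub_mul_cos_sq hx
    have hp : (1 : ℝ) / 8 ≤ 2 / Real.pi ^ 2 := by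
      rw [div_le_div_iff₀ (by norm_num) (by positivity)]
      nlinarith [Real.pi_le_four, Real.pi_pos]
    unfold symb
    nlinarith [sq_nonneg x]
  have hx2 : x ^ 2 ≤ 16 := by
    have h4 := Real.pi_le_four
    rw [← sq_abs]
    nlinarith [abs_nonneg x]
  have h1 : 1 / (1 + L * symb x) ≤ 1 / (1 + L * (x ^ 2 / 4)) := by gcongr
  refine h1.trans ?_
  rw [← div_eq_mul_inv, div_le_div_iff₀ (by positivity) (by positivity)]
  have h5 : J ^ 2 * x ^ 2 ≤ (2 * L + 8) * x ^ 2 := by gcongr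
  have h6 : 0 ≤ L * x ^ 2 := by positivity
  nlinarith

theorem integral_weight_le {J : ℝ} (hJ : 0 < J) :
    ∫ x in (-Real.pi)..Real.pi, (1 + (J * x) ^ 2)⁻¹ ≤ Real.pi / J := by
  have := intervalIntegral.integral_comp_mul_left (a := -Real.pi) (b := Real.pi)
    (fun y : ℝ => (1 + y ^ 2)⁻¹) hJ.ne'
  rw [this, integral_inv_one_add_sq, smul_eq_mul, mul_comm, ← div_eq_mul_inv]
  gcongr
  linarith [Real.arctan_lt_pi_div_two (J * Real.pi), Real.neg_pi_div_two_lt_arctan (J * -Real.pi)]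

/-- The Fourier coefficients of `resSymb`. -/
noncomputable def resKernel (δ : ℝ) (m : ℕ) (j : ℤ) : ℂ := fcoef (fun x => (resSymb δ m x : ℂ)) j

/-- A bound for the `ℓ¹` norm of the kernels `resKernel`. -/
noncomputable def kernelBound : ℝ := (8 + 129 * 640 * Real.pi / Real.pi) / 2

theorem kernelBound_pos : 0 < kernelBound := by
  unfold kernelBound
  have := Real.pi_pos
  positivity

theorem resKernel_summable {δ : ℝ} (hδ : 0 ≤ δ) (m : ℕ) :
    Summable (fun j => ‖resKernel δ m j‖) ∧ ∑' j, ‖resKernel δ m j‖ ≤ kernelBound := by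
  have hpi := Real.pi_pos
  set L : ℝ := (m + 1 : ℕ) * δ with hLdef
  have hL : 0 ≤ L := by positivity
  -- The symbol lives at the scale `|x| ~ 1/J` with `J² ~ L + 1`; this choice gives `L + 1 ≤ J² ≤ 2L
  -- + 8`.
  set J : ℕ := ⌈Real.sqrt L⌉₊ + 1 with hJdef
  have hJ1 : 1 ≤ J := by omega
  have hJR : (1 : ℝ) ≤ J := by exact_mod_cast hJ1
  have hJ0 : (0 : ℝ) < J := by linarith
  have hsq := Real.sq_sqrt hL
  have hs0 := Real.sqrt_nonneg L
  have hlow : Real.sqrt L + 1 ≤ J := by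
    rw [hJdef]
    push_cast
    linarith [Nat.le_ceil (Real.sqrt L)]
  have hup : (J : ℝ) ≤ Real.sqrt L + 2 := by
    rw [hJdef]
    push_cast
    linarith [Nat.ceil_lt_add_one hs0]
  have hJL : L + 1 ≤ (J : ℝ) ^ 2 := by nlinarith
  have hJU : (J : ℝ) ^ 2 ≤ 2 * L + 8 := by nlinarith [sq_nonneg (Real.sqrt L - 2)]
  have habs : ∀ x ∈ Icc (-Real.pi) Real.pi, |x| ≤ Real.pi := fun x hx => abs_le.2 hx
  have hwc : Continuous (fun x : ℝ => (1 + ((J : ℝ) * x) ^ 2)⁻¹) :=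
    Continuous.inv₀ (by fun_prop) fun x => by positivity
  have hX : ∀ x, 0 < 1 / (1 + L * symb x) ∧ 1 / (1 + L * symb x) ≤ 1 := by
    intro x
    have := mul_nonneg hL (symb_nonneg x)
    refine ⟨by positivity, ?_⟩
    rw [div_le_one (by positivity)]
    linarith
  have hc := continuous_resSymb hδ m
  have hc' := continuous_resSymbDeriv hδ m
  refine fcoef_summable_of_deriv (f' := fun x => (resSymbDeriv δ m x : ℂ))
    (fun x => (hasDerivAt_resSymb hδ m x).ofReal_comp)
    (Complex.continuous_ofReal.comp hc') ?_ hJ1 ?_ ?_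
  · simp [resSymb, symb]
  · calc ∫ x in (-Real.pi)..Real.pi, ‖(resSymb δ m x : ℂ)‖ ^ 2
        ≤ ∫ x in (-Real.pi)..Real.pi, 129 * 640 * (1 + ((J : ℝ) * x) ^ 2)⁻¹ := by
          refine intervalIntegral.integral_mono_on (by linarith)
            (Continuous.intervalIntegrable (by fun_prop) _ _)
            (Continuous.intervalIntegrable (by fun_prop) _ _) fun x hx => ?_
          obtain ⟨h0, h1⟩ := resSymb_le hδ m x
          obtain ⟨h2, h3⟩ := hX x
          have h4 := inv_one_add_symb_le hL hJU (habs x hx)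
          rw [Complex.norm_real, Real.norm_of_nonneg h0]
          rw [← hLdef] at h1
          nlinarith
      _ ≤ 129 * 640 * Real.pi / J := by
          rw [intervalIntegral.integral_const_mul, mul_div_assoc]
          have := integral_weight_le hJ0
          gcongr
  · calc ∫ x in (-Real.pi)..Real.pi, ‖(resSymbDeriv δ m x : ℂ)‖ ^ 2
        ≤ ∫ x in (-Real.pi)..Real.pi, 129 * 640 * (J : ℝ) ^ 2 * (1 + ((J : ℝ) * x) ^ 2)⁻¹ := by
          refine intervalIntegral.integral_mono_on (by linarith)
            (Continuous.intervalIntegrable (by fun_prop) _ _)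
            (Continuous.intervalIntegrable (by fun_prop) _ _) fun x hx => ?_
          have h1 := abs_resSymbDeriv_le hδ m x
          obtain ⟨h2, h3⟩ := hX x
          have h4 := inv_one_add_symb_le hL hJU (habs x hx)
          have hs := symb_nonneg x
          rw [← hLdef] at h1
          rw [Complex.norm_real, Real.norm_eq_abs]
          -- In the square of the derivative, `sin²` is absorbed by one factor `(L + 1) X`, leaving
          -- a single `X` to integrate. The resulting `64 · 5 = 320` is below the constant `640`.
          have h5 : (L + 1) * symb x * (1 / (1 + L * symb x)) ≤ 5 := by
            have hLs := mul_nonneg hL hs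
            rw [mul_one_div, div_le_iff₀ (by positivity)]
            linarith [symb_le x]
          set X := 1 / (1 + L * symb x)
          calc |resSymbDeriv δ m x| ^ 2 ≤ (|2 * Real.sin x| * (4 * (L + 1) * X)) ^ 2 := by
                gcongr
            _ = (2 * Real.sin x) ^ 2 * (4 * (L + 1) * X) ^ 2 := by rw [mul_pow, sq_abs]
            _ ≤ 4 * symb x * (4 * (L + 1) * X) ^ 2 := by
                gcongr
                exact sq_sin_le_symb x
            _ = 64 * (L + 1) * X * ((L + 1) * symb x * X) := by ring
            _ ≤ 64 * (L + 1) * X * 5 := by gcongr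
            _ ≤ 64 * (J : ℝ) ^ 2 * (129 * (1 + ((J : ℝ) * x) ^ 2)⁻¹) * 5 := by gcongr
            _ ≤ _ := by
                have : 0 ≤ (J : ℝ) ^ 2 * (1 + ((J : ℝ) * x) ^ 2)⁻¹ := by positivity
                linarith
      _ ≤ 129 * 640 * Real.pi * J := by
          rw [intervalIntegral.integral_const_mul]
          calc _ ≤ 129 * 640 * (J : ℝ) ^ 2 * (Real.pi / J) := by
                have := integral_weight_le hJ0
                gcongr
            _ = _ := by field_simp

theorem resKernel_zero {δ : ℝ} (hδ : 0 ≤ δ) (c : ℝ) (hc : c = 1 / 12 - δ) (j : ℤ) :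
    (1 - 2 * (c : ℂ)) * resKernel δ 0 j + c * (resKernel δ 0 (j + 1) + resKernel δ 0 (j - 1))
      = if j = 0 then 1 else 0 := by
  unfold resKernel
  rw [fcoef_tridiagonal (f := fun x => (resSymb δ 0 x : ℂ))
    (Complex.continuous_ofReal.comp (continuous_resSymb hδ 0)), ← fcoef_one]
  congr 1
  ext x
  have hd := resSymb_den_pos hδ x
  change (1 - (c : ℂ) * (symb x : ℝ)) * (resSymb δ 0 x : ℂ) = 1
  have : (1 - c * symb x) * resSymb δ 0 x = 1 := by
    rw [show 1 - c * symb x = 1 - symb x / 12 + δ * symb x by rw [hc]; ring]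
    unfold resSymb
    rw [zero_add, pow_zero, pow_one, mul_one_div_cancel hd.ne']
  exact_mod_cast this

theorem resKernel_succ {δ : ℝ} (hδ : 0 ≤ δ) (c : ℝ) (hc : c = 1 / 12 - δ) (m : ℕ) (j : ℤ) :
    (1 - 2 * (c : ℂ)) * resKernel δ (m + 1) j
        + c * (resKernel δ (m + 1) (j + 1) + resKernel δ (m + 1) (j - 1))
      = (1 - 2 * (1 / 12)) * resKernel δ m j
        + 1 / 12 * (resKernel δ m (j + 1) + resKernel δ m (j - 1)) := by
  unfold resKernel
  rw [fcoef_tridiagonal (f := fun x => (resSymb δ (m + 1) x : ℂ))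
      (Complex.continuous_ofReal.comp (continuous_resSymb hδ _)),
    fcoef_tridiagonal (f := fun x => (resSymb δ m x : ℂ))
      (Complex.continuous_ofReal.comp (continuous_resSymb hδ _))]
  congr 1
  ext x
  have hd := resSymb_den_pos hδ x
  change (1 - (c : ℂ) * (symb x : ℝ)) * (resSymb δ (m + 1) x : ℂ)
    = (1 - 1 / 12 * (symb x : ℝ)) * (resSymb δ m x : ℂ)
  have : (1 - c * symb x) * resSymb δ (m + 1) x = (1 - 1 / 12 * symb x) * resSymb δ m x := by
    rw [show 1 - c * symb x = 1 - symb x / 12 + δ * symb x by rw [hc]; ring,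
      show 1 - 1 / 12 * symb x = 1 - symb x / 12 by ring]
    unfold resSymb
    set d := 1 - symb x / 12 + δ * symb x
    rw [pow_succ d (m + 1), pow_succ (1 - symb x / 12) m]
    field_simp
  have h := congrArg (fun r : ℝ => (r : ℂ)) this
  push_cast at h
  exact h

/-! ### Maximum norm stability on the integer lattice -/

/-- The tridiagonal operator `v ↦ v - c S v`, with `(S v)_j = 2 v_j - v_{j+1} - v_{j-1}`. -/
noncomputable def tri (c : ℂ) (v : ℤ → ℂ) (j : ℤ) : ℂ := (1 - 2 * c) * v j + c * (v (j + 1) + v (j - 1))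

/-- Correlation of a summable with a bounded sequence. -/
noncomputable def corr (b v : ℤ → ℂ) (j : ℤ) : ℂ := ∑' i, b i * v (j + i)

theorem summable_corr {b v : ℤ → ℂ} (hb : Summable fun j => ‖b j‖) {B : ℝ} (hv : ∀ j, ‖v j‖ ≤ B)
    (e : ℤ → ℤ) : Summable fun i => b i * v (e i) := by
  refine Summable.of_norm_bounded (hb.mul_right B) fun i => ?_
  rw [norm_mul]
  exact mul_le_mul_of_nonneg_left (hv _) (norm_nonneg _)

theorem norm_corr_le {b v : ℤ → ℂ} (hb : Summable fun j => ‖b j‖) {B : ℝ} (hv : ∀ j, ‖v j‖ ≤ B)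
    (j : ℤ) : ‖corr b v j‖ ≤ (∑' i, ‖b i‖) * B := by
  unfold corr
  rw [← tsum_mul_right]
  refine tsum_of_norm_bounded (hb.mul_right B).hasSum fun i => ?_
  rw [norm_mul]
  exact mul_le_mul_of_nonneg_left (hv _) (norm_nonneg _)

theorem corr_comp_equiv (b v : ℤ → ℂ) (e : ℤ ≃ ℤ) (j : ℤ) :
    ∑' i, b (e i) * v (j + i) = ∑' i, b i * v (j + e.symm i) := by
  rw [← e.tsum_eq fun i => b i * v (j + e.symm i)]
  simp only [Equiv.symm_apply_apply]

theorem tsum_add_tsum {a₁ a₂ a₃ : ℤ → ℂ} (h₁ : Summable a₁) (h₂ : Summable a₂) (h₃ : Summable a₃)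
    (p q : ℂ) : ∑' i, (p * a₁ i + q * (a₂ i + a₃ i))
      = p * ∑' i, a₁ i + q * (∑' i, a₂ i + ∑' i, a₃ i) :=
  ((h₁.hasSum.mul_left p).add ((h₂.hasSum.add h₃.hasSum).mul_left q)).tsum_eq

/-- Summation by parts: the operator is symmetric, so it can be moved between the kernel and the
sequence. Summability of `b` and boundedness of `v` justify the rearrangement. -/
theorem corr_tri (c : ℂ) {b v : ℤ → ℂ} (hb : Summable fun j => ‖b j‖) {B : ℝ}
    (hv : ∀ j, ‖v j‖ ≤ B) (j : ℤ) : corr (tri c b) v j = corr b (tri c v) j := by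
  have s0 := summable_corr hb hv (fun i => j + i)
  have s1 := summable_corr hb hv (fun i => j + i + 1)
  have s2 := summable_corr hb hv (fun i => j + i - 1)
  have s3 := summable_corr (b := fun i => b (i + 1))
    (hb.comp_injective (add_left_injective (1 : ℤ))) hv (fun i => j + i)
  have s4 := summable_corr (b := fun i => b (i - 1))
    (hb.comp_injective (sub_left_injective (b := (1 : ℤ)))) hv (fun i => j + i)
  have e1 := corr_comp_equiv b v (Equiv.addRight (1 : ℤ)) j
  have e2 := corr_comp_equiv b v (Equiv.subRight (1 : ℤ)) j
  simp only [Equiv.coe_addRight, Equiv.addRight_symm, Equiv.subRight_apply,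
    Equiv.subRight_symm_apply] at e1 e2
  have l1 : corr (tri c b) v j = (1 - 2 * c) * (∑' i, b i * v (j + i))
      + c * (∑' i, b (i + 1) * v (j + i) + ∑' i, b (i - 1) * v (j + i)) := by
    rw [← tsum_add_tsum s0 s3 s4]
    refine tsum_congr fun i => ?_
    simp only [tri]
    ring
  have l2 : corr b (tri c v) j = (1 - 2 * c) * (∑' i, b i * v (j + i))
      + c * (∑' i, b i * v (j + i + 1) + ∑' i, b i * v (j + i - 1)) := by
    rw [← tsum_add_tsum s0 s1 s2]
    refine tsum_congr fun i => ?_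
    simp only [tri]
    ring
  rw [l1, l2, e1, e2, add_comm (∑' i, b i * v (j + (i + -1)))]
  simp only [add_assoc, sub_eq_add_neg]

theorem norm_tri_le (c : ℂ) {v : ℤ → ℂ} {B : ℝ} (hv : ∀ j, ‖v j‖ ≤ B) (j : ℤ) :
    ‖tri c v j‖ ≤ ‖1 - 2 * c‖ * B + ‖c‖ * (B + B) := by
  unfold tri
  refine (norm_add_le _ _).trans ?_
  rw [norm_mul, norm_mul]
  have := (norm_add_le (v (j + 1)) (v (j - 1))).trans (add_le_add (hv _) (hv _))
  have := hv j
  gcongr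

theorem corr_add {b u v : ℤ → ℂ} (hb : Summable fun j => ‖b j‖) {B B' : ℝ}
    (hu : ∀ j, ‖u j‖ ≤ B) (hv : ∀ j, ‖v j‖ ≤ B') (j : ℤ) :
    corr b (fun i => u i + v i) j = corr b u j + corr b v j := by
  unfold corr
  rw [← (summable_corr hb hu _).tsum_add (summable_corr hb hv _)]
  simp only [mul_add]

theorem corr_sum {ι : Type*} (s : Finset ι) {b : ℤ → ℂ} (a : ι → ℂ) (v : ι → ℤ → ℂ)
    (hb : Summable fun j => ‖b j‖) {B : ι → ℝ} (hv : ∀ k, ∀ j, ‖v k j‖ ≤ B k) (j : ℤ) :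
    corr b (fun i => ∑ k ∈ s, a k * v k i) j = ∑ k ∈ s, a k * corr b (v k) j := by
  unfold corr
  simp_rw [← tsum_mul_left, Finset.mul_sum]
  rw [Summable.tsum_finsetSum]
  · refine Finset.sum_congr rfl fun k _ => tsum_congr fun i => ?_
    ring
  · intro k _
    refine ((summable_corr hb (hv k) (fun i => j + i)).mul_left (a k)).congr fun i => ?_
    ring

theorem sum_range_coeff_succ (α : ℝ) (n : ℕ) :
    ∑ k ∈ Finset.range n, coeff α (k + 1) = coeffSum α n - 1 := by
  unfold coeffSum
  rw [Finset.sum_range_succ', coeff_zero]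
  ring

/-- Unconditional maximum norm stability of the compact scheme with Grünwald memory terms. -/
theorem lattice_stability {α : ℝ} (h0 : 0 < α) (h1 : α < 1) {δ : ℝ} (hδ : 0 ≤ δ) {c : ℝ}
    (hc : c = 1 / 12 - δ) {ε r : ℕ → ℤ → ℂ} {N : ℕ} {Y : ℝ}
    (hbdd : ∀ n, ∃ B, ∀ j, ‖ε n j‖ ≤ B) (hε0 : ∀ j, ε 0 j = 0)
    (heq : ∀ n, 1 ≤ n → n ≤ N → ∀ j, tri c (ε n) j
      = ∑ k ∈ Finset.range n, -(coeff α (k + 1) : ℂ) * tri (1 / 12) (ε (n - 1 - k)) j + r n j)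
    (hr : ∀ n, 1 ≤ n → n ≤ N → ∀ j, ‖r n j‖ ≤ coeffSum α n * Y) (hY : 0 ≤ Y) :
    ∀ n ≤ N, ∀ j, ‖ε n j‖ ≤ kernelBound * Y := by
  choose B hB using hbdd
  have hK := kernelBound_pos
  have hb := fun m => (resKernel_summable hδ m).1
  have hb' := fun m => (resKernel_summable hδ m).2
  -- In symbols, `(w + δ s) · w^(m+1)/(w + δ s)^(m+2) = w · w^m/(w + δ s)^(m+1)`. This trades
  -- averaging of an earlier level for one more power in the induction hypothesis.
  have hsucc : ∀ m, tri c (resKernel δ (m + 1)) = tri (1 / 12) (resKernel δ m) := by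
    intro m
    ext j
    exact resKernel_succ hδ c hc m j
  -- The correlated sequence is `(w/(w + δ s))^m ε_n`. Quantifying over all `m` inside the induction
  -- on `n` is essential, since level `n` at power `m` uses earlier levels at power `m + 1`.
  have key : ∀ n ≤ N, ∀ m j, ‖corr (tri c (resKernel δ m)) (ε n) j‖ ≤ kernelBound * Y := by
    intro n
    induction n using Nat.strong_induction_on with
    | _ n ih =>
      intro hn m j
      rcases Nat.eq_zero_or_pos n with rfl | hpos
      · simp only [corr, hε0, mul_zero, tsum_zero, norm_zero]
        positivity
      · rw [corr_tri c (hb m) (hB n), show tri (c : ℂ) (ε n) = fun j => _ from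
          funext (heq n hpos hn),
          corr_add (hb m) (u := fun j => ∑ k ∈ Finset.range n,
            -(coeff α (k + 1) : ℂ) * tri (1 / 12) (ε (n - 1 - k)) j)
            (B := ∑ k ∈ Finset.range n, ‖-(coeff α (k + 1) : ℂ)‖ *
              (‖1 - 2 * (1 / 12 : ℂ)‖ * B (n - 1 - k) + ‖(1 / 12 : ℂ)‖ *
                (B (n - 1 - k) + B (n - 1 - k)))) ?_ (hr n hpos hn),
          corr_sum _ _ (fun k => tri (1 / 12) (ε (n - 1 - k))) (hb m)
            (fun k => norm_tri_le _ (hB _))]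
        · have e1 : ∀ k ∈ Finset.range n,
              ‖-(coeff α (k + 1) : ℂ) *
                corr (resKernel δ m) (tri (1 / 12) (ε (n - 1 - k))) j‖
              ≤ -coeff α (k + 1) * (kernelBound * Y) := by
            intro k hk
            rw [Finset.mem_range] at hk
            have hl := coeff_succ_nonpos h0 h1 k
            rw [← corr_tri _ (hb m) (hB _), ← hsucc, norm_mul, norm_neg, Complex.norm_real,
              Real.norm_of_nonpos hl]
            exact mul_le_mul_of_nonneg_left (ih _ (by omega) (by omega) _ _) (by linarith)
          have e2 : ‖corr (resKernel δ m) (r n) j‖ ≤ kernelBound * (coeffSum α n * Y) := by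
            refine (norm_corr_le (hb m) (hr n hpos hn) j).trans ?_
            have := coeffSum_pos h1 n
            exact mul_le_mul_of_nonneg_right (hb' m) (by positivity)
          -- The memory terms carry total weight `1 - A_n` and the residual `A_n`, so the same bound
          -- is reproduced without growth in `n`.
          calc _ ≤ ∑ k ∈ Finset.range n, -coeff α (k + 1) * (kernelBound * Y)
                + kernelBound * (coeffSum α n * Y) :=
                (norm_add_le _ _).trans (add_le_add (norm_sum_le_of_le _ e1) e2)
            _ = kernelBound * Y := by
                rw [← Finset.sum_mul, Finset.sum_neg_distrib, sum_range_coeff_succ]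
                ring
        · intro i
          refine norm_sum_le_of_le _ fun k _ => ?_
          rw [norm_mul]
          exact mul_le_mul_of_nonneg_left (norm_tri_le _ (hB _) _) (norm_nonneg _)
  intro n hn j
  -- At `m = 0` the symbol is `1`, so the kernel is the unit mass at zero and the correlation
  -- returns `ε_n` itself.
  have hz : tri c (resKernel δ 0) = fun j => if j = 0 then 1 else 0 := by
    ext j
    exact resKernel_zero hδ c hc j
  have := key n hn 0 j
  rw [hz] at this
  simpa [corr, ite_mul] using this

/-! ### Grid functions with zero boundary values -/

/-- The odd `2 M`-periodic extension of a grid function on `0, …, M`. -/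
noncomputable def oddExt (M : ℕ) (v : ℕ → ℂ) (j : ℤ) : ℂ :=
  if j % (2 * M : ℤ) ≤ M then v (j % (2 * M : ℤ)).toNat
  else -v (2 * M - j % (2 * M : ℤ)).toNat

theorem norm_oddExt_le {M : ℕ} (hM : 1 ≤ M) {v : ℕ → ℂ} {B : ℝ} (hv : ∀ i ≤ M, ‖v i‖ ≤ B)
    (j : ℤ) : ‖oddExt M v j‖ ≤ B := by
  have h1 := Int.emod_nonneg j (show (2 * M : ℤ) ≠ 0 by omega)
  have h2 := Int.emod_lt_of_pos j (show (0 : ℤ) < 2 * M by omega)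
  unfold oddExt
  split_ifs with h
  · exact hv _ (by omega)
  · rw [norm_neg]
    exact hv _ (by omega)

theorem oddExt_natCast {M : ℕ} {v : ℕ → ℂ} {i : ℕ} (hi : i ≤ M) (hM : 1 ≤ M) :
    oddExt M v i = v i := by
  have : (i : ℤ) % (2 * M : ℤ) = i := Int.emod_eq_of_lt (by omega) (by omega)
  unfold oddExt
  rw [this, if_pos (by omega), Int.toNat_natCast]

theorem oddExt_of_emod {M : ℕ} (hM : 1 ≤ M) {v : ℕ → ℂ} (h0 : v 0 = 0) (hvM : v M = 0) {j : ℤ}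
    {i : ℕ} (hi : i ≤ M) :
    (j % (2 * M : ℤ) = i → oddExt M v j = v i) ∧
    (j % (2 * M : ℤ) = (2 * M - i) % (2 * M : ℤ) → oddExt M v j = -v i) := by
  constructor
  · intro h
    unfold oddExt
    rw [h, if_pos (by omega), Int.toNat_natCast]
  · intro h
    unfold oddExt
    rcases Nat.eq_zero_or_pos i with rfl | hpos
    · rw [h]
      simp [h0]
    · rw [h, Int.emod_eq_of_lt (by omega) (by omega)]
      split_ifs with hh
      · have : i = M := by omega
        subst this
        rw [show (2 * i - i : ℤ).toNat = i by omega, hvM, neg_zero]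
      · congr 2
        omega

/-- Odd reflection about `0` and `M` makes the neighbours of a boundary node cancel, so there the
operator yields zero, as `w` does. Elsewhere periodicity or sign reversal reduces to an interior
node. -/
theorem tri_oddExt (c : ℂ) {M : ℕ} (hM : 1 ≤ M) {v w : ℕ → ℂ} (h0 : v 0 = 0) (hvM : v M = 0)
    (hw0 : w 0 = 0) (hwM : w M = 0)
    (hw : ∀ i, 1 ≤ i → i ≤ M - 1 → (1 - 2 * c) * v i + c * (v (i + 1) + v (i - 1)) = w i) (j : ℤ) :
    tri c (oddExt M v) j = oddExt M w j := by
  have h1 := Int.emod_nonneg j (show (2 * M : ℤ) ≠ 0 by omega)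
  have h2 := Int.emod_lt_of_pos j (show (0 : ℤ) < 2 * M by omega)
  have hp : ∀ a : ℤ, (j + a) % (2 * M : ℤ) = (j % (2 * M : ℤ) + a) % (2 * M : ℤ) := by
    intro a
    rw [Int.emod_add_emod]
  have E := fun (j : ℤ) (i : ℕ) (hi : i ≤ M) => oddExt_of_emod hM h0 hvM (j := j) hi
  have E' := fun (j : ℤ) (i : ℕ) (hi : i ≤ M) => oddExt_of_emod hM hw0 hwM (j := j) hi
  obtain ⟨i, hi⟩ := Int.eq_ofNat_of_zero_le h1
  have hp1 := hp 1
  have hp2 := hp (-1)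
  rw [hi] at hp1 hp2
  unfold tri
  rw [sub_eq_add_neg j 1]
  rcases Nat.eq_zero_or_pos i with hi0 | hpos
  · subst hi0
    rw [(E j 0 (by omega)).1 hi, (E' j 0 (by omega)).1 hi, (E (j + 1) 1 (by omega)).1,
      (E (j + -1) 1 (by omega)).2, h0, hw0]
    · ring
    · rw [hp2]
      rw [← Int.add_emod_right]
      congr 1
    · rw [hp1]
      exact Int.emod_eq_of_lt (by omega) (by omega)
  rcases lt_trichotomy i M with hiM | hiM | hiM
  · rw [(E j i (by omega)).1 hi, (E' j i (by omega)).1 hi, (E (j + 1) (i + 1) (by omega)).1,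
      (E (j + -1) (i - 1) (by omega)).1, hw i (by omega) (by omega)]
    · rw [hp2]
      rw [Int.emod_eq_of_lt (by omega) (by omega)]
      omega
    · rw [hp1]
      rw [Int.emod_eq_of_lt (by omega) (by omega)]
      omega
  · subst hiM
    rw [(E j i (by omega)).1 hi, (E' j i (by omega)).1 hi, (E (j + 1) (i - 1) (by omega)).2,
      (E (j + -1) (i - 1) (by omega)).1, hvM, hwM]
    · ring
    · rw [hp2]
      rw [Int.emod_eq_of_lt (by omega) (by omega)]
      omega
    · rw [hp1]
      congr 1
      push_cast [Nat.cast_sub hM]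
      ring
  · have hi' : i < 2 * M := by omega
    rw [(E j (2 * M - i) (by omega)).2, (E' j (2 * M - i) (by omega)).2,
      (E (j + 1) (2 * M - i - 1) (by omega)).2,
      (E (j + -1) (2 * M - i + 1) (by omega)).2, ← hw (2 * M - i) (by omega) (by omega)]
    · ring
    · rw [hp2]
      congr 1
      omega
    · rw [hp1]
      congr 1
      omega
    · rw [hi, Int.emod_eq_of_lt (by omega) (by omega)]
      omega
    · rw [hi, Int.emod_eq_of_lt (by omega) (by omega)]
      omega

theorem oddExt_sum {ι : Type*} (s : Finset ι) (M : ℕ) (a : ι → ℂ) (v : ι → ℕ → ℂ) (w : ℕ → ℂ) (j : ℤ) :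
    oddExt M (fun i => ∑ k ∈ s, a k * v k i + w i) j
      = ∑ k ∈ s, a k * oddExt M (v k) j + oddExt M w j := by
  unfold oddExt
  split_ifs
  · rfl
  · rw [neg_add, ← Finset.sum_neg_distrib]
    simp only [mul_neg]

/-- Maximum norm stability of the compact scheme for grid functions that vanish at the boundary. -/
theorem grid_stability {α : ℝ} (h0 : 0 < α) (h1 : α < 1) {δ : ℝ} (hδ : 0 ≤ δ) {M N : ℕ}
    (hM : 1 ≤ M) {e r : ℕ → ℕ → ℂ} {Y : ℝ} (hY : 0 ≤ Y)
    (he0 : ∀ i ≤ M, e 0 i = 0) (hl : ∀ n ≤ N, e n 0 = 0) (hr : ∀ n ≤ N, e n M = 0)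
    (heq : ∀ n, 1 ≤ n → n ≤ N → ∀ i, 1 ≤ i → i ≤ M - 1 →
      ∑ k ∈ Finset.range (n + 1), (coeff α k : ℂ) *
        ((e (n - k) (i + 1) + 10 * e (n - k) i + e (n - k) (i - 1)) / 12)
      = δ * (e n (i + 1) - 2 * e n i + e n (i - 1)) + r n i)
    (hres : ∀ n, 1 ≤ n → n ≤ N → ∀ i, 1 ≤ i → i ≤ M - 1 → ‖r n i‖ ≤ coeffSum α n * Y) :
    ∀ n ≤ N, ∀ i ≤ M, ‖e n i‖ ≤ kernelBound * Y := by
  -- The averaged error and the residual are set to zero at both ends, the values forced there by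
  -- odd extension.
  set H : ℕ → ℕ → ℂ := fun n i => if 1 ≤ i ∧ i ≤ M - 1 then
    (1 - 2 * (1 / 12)) * e n i + 1 / 12 * (e n (i + 1) + e n (i - 1)) else 0 with hH
  set w : ℕ → ℕ → ℂ := fun n i => if 1 ≤ i ∧ i ≤ M - 1 then r n i else 0 with hw
  have hH0 : ∀ n, H n 0 = 0 := fun n => by simp [hH]
  have hHM : ∀ n, H n M = 0 := fun n => by
    simp only [hH]
    rw [if_neg (by omega)]
  have hw0 : ∀ n, w n 0 = 0 := fun n => by simp [hw]
  have hwM : ∀ n, w n M = 0 := fun n => by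
    simp only [hw]
    rw [if_neg (by omega)]
  have key := lattice_stability h0 h1 hδ (c := 1 / 12 - δ) rfl (N := N) (Y := Y)
    (ε := fun n => oddExt M (e n)) (r := fun n => oddExt M (w n)) ?_ ?_ ?_ ?_ hY
  · intro n hn i hi
    have := key n hn i
    rwa [oddExt_natCast hi hM] at this
  · intro n
    refine ⟨∑ i ∈ Finset.range (M + 1), ‖e n i‖, norm_oddExt_le hM fun i hi => ?_⟩
    exact Finset.single_le_sum (f := fun i => ‖e n i‖) (fun _ _ => norm_nonneg _)
      (Finset.mem_range.2 (by omega))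
  · intro j
    have := norm_oddExt_le hM (v := e 0) (B := 0) (fun i hi => by rw [he0 i hi, norm_zero]) j
    simpa using this
  · intro n hn hnN j
    have e1 : ∀ k ∈ Finset.range n, -(coeff α (k + 1) : ℂ) *
        tri (1 / 12) (oddExt M (e (n - 1 - k))) j
        = -(coeff α (k + 1) : ℂ) * oddExt M (H (n - 1 - k)) j := by
      intro k hk
      rw [Finset.mem_range] at hk
      rw [tri_oddExt (1 / 12) hM (hl _ (by omega)) (hr _ (by omega)) (hH0 _) (hHM _)]
      intro i h1 h2
      simp only [hH]
      rw [if_pos ⟨h1, h2⟩]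
    rw [Finset.sum_congr rfl e1, ← oddExt_sum]
    refine tri_oddExt _ hM (hl n hnN) (hr n hnN) ?_ ?_ ?_ j
    · simp [hH0, hw0]
    · simp [hHM, hwM]
    · intro i h1 h2
      have h := heq n hn hnN i h1 h2
      rw [Finset.sum_range_succ', coeff_zero] at h
      have e2 : ∑ k ∈ Finset.range n, -(coeff α (k + 1) : ℂ) * H (n - 1 - k) i
          = -∑ k ∈ Finset.range n, (coeff α (k + 1) : ℂ) *
            ((e (n - (k + 1)) (i + 1) + 10 * e (n - (k + 1)) i + e (n - (k + 1)) (i - 1)) / 12) := by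
        rw [← Finset.sum_neg_distrib]
        refine Finset.sum_congr rfl fun k _ => ?_
        simp only [hH]
        rw [if_pos ⟨h1, h2⟩, Nat.sub_sub, add_comm 1 k]
        ring
      rw [e2]
      simp only [hw]
      rw [if_pos ⟨h1, h2⟩]
      rw [Nat.sub_zero] at h
      push_cast at h ⊢
      linear_combination h
  · intro n hn hnN
    refine norm_oddExt_le hM fun i _ => ?_
    simp only [hw]
    split_ifs with hi
    · exact hres n hn hnN i hi.1 hi.2
    · rw [norm_zero]
      have := coeffSum_pos h1 n
      positivity

/-! ### Truncation error of the Grünwald formula -/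

theorem abel_sum (a : ℕ → ℝ) (x : ℕ → ℂ) (n : ℕ) :
    ∑ k ∈ Finset.range (n + 1), (a k : ℂ) * x k
      = ∑ m ∈ Finset.range n, ((∑ k ∈ Finset.range (m + 1), a k : ℝ) : ℂ) * (x m - x (m + 1))
        + ((∑ k ∈ Finset.range (n + 1), a k : ℝ) : ℂ) * x n := by
  induction n with
  | zero => simp
  | succ n ih =>
    rw [Finset.sum_range_succ (fun k => (a k : ℂ) * x k) (n + 1), ih,
      Finset.sum_range_succ
        (fun m => ((∑ k ∈ Finset.range (m + 1), a k : ℝ) : ℂ) * (x m - x (m + 1))) n,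
      Finset.sum_range_succ a (n + 1)]
    push_cast
    ring

/-- Mean value inequality for `t ↦ G t - t G'(s)`, with `s` anywhere in the cell; only a Lipschitz
derivative is used. -/
theorem norm_sub_sub_smul_le {G G' : ℝ → ℂ} {T C : ℝ}
    (hG : ∀ t ∈ Icc 0 T, HasDerivWithinAt G (G' t) (Icc 0 T) t)
    (hL : ∀ s ∈ Icc 0 T, ∀ t ∈ Icc 0 T, ‖G' s - G' t‖ ≤ C * |s - t|) (hC : 0 ≤ C) {a b s : ℝ}
    (ha : 0 ≤ a) (hab : a ≤ b) (hb : b ≤ T) (hs : s ∈ Icc a b) :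
    ‖G b - G a - (b - a : ℝ) * G' s‖ ≤ C * (b - a) ^ 2 := by
  have hsub : Icc a b ⊆ Icc 0 T := Icc_subset_Icc ha hb
  have h := (convex_Icc a b).norm_image_sub_le_of_norm_hasDerivWithin_le
    (f := fun t : ℝ => G t - t * G' s) (f' := fun t => G' t - G' s) (C := C * (b - a))
    (fun t ht => ?_) (fun t ht => ?_) (left_mem_Icc.2 hab) (right_mem_Icc.2 hab)
  · rw [Real.norm_of_nonneg (by linarith)] at h
    calc _ = ‖G b - b * G' s - (G a - a * G' s)‖ := by
          congr 1
          push_cast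
          ring
      _ ≤ _ := h
      _ = _ := by ring
  · refine HasDerivWithinAt.sub ((hG t (hsub ht)).mono hsub) ?_
    have := ((hasDerivAt_id t).ofReal_comp.mul_const (G' s)).hasDerivWithinAt (s := Icc a b)
    simpa using this
  · refine (hL t (hsub ht) s (hsub hs)).trans ?_
    gcongr
    rw [abs_le]
    constructor <;> linarith [ht.1, ht.2, hs.1, hs.2]

/-- The Riemann-Liouville integral of order `1 - α` of `g`, after the substitution `u = t - s`. -/
noncomputable def fracInt (α : ℝ) (g : ℝ → ℂ) (t : ℝ) : ℂ :=
  (1 / (Real.Gamma (1 - α) : ℂ)) * ∫ u in (0 : ℝ)..t, ((u ^ (-α) : ℝ) : ℂ) * g (t - u)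

theorem integral_rpow_neg {α : ℝ} (h1 : α < 1) (a b : ℝ) :
    ∫ u in a..b, u ^ (-α) = (b ^ (1 - α) - a ^ (1 - α)) / (1 - α) := by
  rw [integral_rpow (Or.inl (by linarith)), show -α + 1 = 1 - α by ring]

theorem intervalIntegrable_rpow_ofReal {α : ℝ} (h1 : α < 1) (a b : ℝ) :
    IntervalIntegrable (fun u : ℝ => ((u ^ (-α) : ℝ) : ℂ)) MeasureTheory.volume a b :=
  have h : IntervalIntegrable (fun u : ℝ => u ^ (-α)) MeasureTheory.volume a b :=
    intervalIntegral.intervalIntegrable_rpow' (by linarith : -1 < -α)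
  ⟨h.1.ofReal, h.2.ofReal⟩

theorem intervalIntegrable_rpow_mul {α : ℝ} (h1 : α < 1) {g : ℝ → ℂ} {a b : ℝ}
    (hg : ContinuousOn g (uIcc a b)) :
    IntervalIntegrable (fun u => ((u ^ (-α) : ℝ) : ℂ) * g u) MeasureTheory.volume a b :=
  IntervalIntegrable.mul_continuousOn
    (intervalIntegrable_rpow_ofReal h1 a b) hg

/-- Replacing `g` by its cell averages in the fractional integral. -/
theorem fracInt_sub_sum_le {α : ℝ} (h1 : α < 1) {G G' : ℝ → ℂ} {T C : ℝ}
    (hG : ∀ t ∈ Icc 0 T, HasDerivWithinAt G (G' t) (Icc 0 T) t)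
    (hL : ∀ s ∈ Icc 0 T, ∀ t ∈ Icc 0 T, ‖G' s - G' t‖ ≤ C * |s - t|) (hC : 0 ≤ C)
    (hc : ContinuousOn G' (Icc 0 T)) {τ : ℝ} (hτ : 0 < τ) {n : ℕ} (hn : n * τ ≤ T) :
    ‖∑ m ∈ Finset.range n, ((((m + 1 : ℕ) : ℝ) ^ (1 - α) - (m : ℝ) ^ (1 - α)) /
        Real.Gamma (2 - α) : ℝ) * (G (n * τ - m * τ) - G (n * τ - (m + 1 : ℕ) * τ))
      - (τ ^ α : ℝ) * fracInt α G' (n * τ)‖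
      ≤ C * (n : ℝ) ^ (1 - α) / Real.Gamma (2 - α) * τ ^ 2 := by
  have h1' : 0 < 1 - α := by linarith
  have hg := Real.Gamma_pos_of_pos h1'
  have e : Real.Gamma (2 - α) = (1 - α) * Real.Gamma (1 - α) := by
    rw [← Real.Gamma_add_one (by linarith)]
    congr 1
    ring
  have hcell : ∀ m < n, ∀ u ∈ Icc (m * τ) ((m + 1 : ℕ) * τ), n * τ - u ∈ Icc 0 T := by
    intro m hm u hu
    have : ((m + 1 : ℕ) : ℝ) ≤ n := by exact_mod_cast hm
    have h2 : ((m + 1 : ℕ) : ℝ) * τ ≤ n * τ := by gcongr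
    have h3 : 0 ≤ (m : ℝ) * τ := by positivity
    exact ⟨by linarith [hu.2], by linarith [hu.1]⟩
  have hmle : ∀ m : ℕ, (m : ℝ) * τ ≤ (m + 1 : ℕ) * τ := by
    intro m
    push_cast
    linarith
  have hint : ∀ m < n, IntervalIntegrable (fun u => ((u ^ (-α) : ℝ) : ℂ) * G' (n * τ - u))
      MeasureTheory.volume (m * τ) ((m + 1 : ℕ) * τ) := by
    intro m hm
    refine intervalIntegrable_rpow_mul h1 (g := fun u => G' (n * τ - u)) ?_
    refine hc.comp (by fun_prop) ?_
    rw [uIcc_of_le (hmle m)]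
    exact hcell m hm
  have hsum : ∫ u in (0 : ℝ)..(n * τ), ((u ^ (-α) : ℝ) : ℂ) * G' (n * τ - u)
      = ∑ m ∈ Finset.range n, ∫ u in (m * τ)..((m + 1 : ℕ) * τ),
        ((u ^ (-α) : ℝ) : ℂ) * G' (n * τ - u) := by
    rw [intervalIntegral.sum_integral_adjacent_intervals (a := fun m : ℕ => (m : ℝ) * τ) hint]
    simp
  have hcellint : ∀ m : ℕ, ∫ u in (m * τ)..((m + 1 : ℕ) * τ), u ^ (-α)
      = τ ^ (1 - α) * ((((m + 1 : ℕ) : ℝ) ^ (1 - α) - (m : ℝ) ^ (1 - α)) / (1 - α)) := by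
    intro m
    rw [integral_rpow_neg h1, Real.mul_rpow (by positivity) hτ.le,
      Real.mul_rpow (by positivity) hτ.le]
    ring
  have hττ : τ ^ α * τ ^ (1 - α) = τ := by
    rw [← Real.rpow_add hτ]
    simp
  have hterm : ∀ m ∈ Finset.range n,
      ‖(((((m + 1 : ℕ) : ℝ) ^ (1 - α) - (m : ℝ) ^ (1 - α)) /
        Real.Gamma (2 - α) : ℝ) : ℂ) * (G (n * τ - m * τ) - G (n * τ - (m + 1 : ℕ) * τ))
      - (τ ^ α : ℝ) * ((1 / (Real.Gamma (1 - α) : ℂ)) * ∫ u in (m * τ)..((m + 1 : ℕ) * τ),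
        ((u ^ (-α) : ℝ) : ℂ) * G' (n * τ - u))‖
      ≤ C / Real.Gamma (2 - α) * τ ^ 2 * (((m + 1 : ℕ) : ℝ) ^ (1 - α) - (m : ℝ) ^ (1 - α)) := by
    intro m hm
    rw [Finset.mem_range] at hm
    set β := ((m + 1 : ℕ) : ℝ) ^ (1 - α) - (m : ℝ) ^ (1 - α) with hβ
    set Δ := G (n * τ - m * τ) - G (n * τ - (m + 1 : ℕ) * τ) with hΔ
    have hri : IntervalIntegrable (fun u : ℝ => u ^ (-α)) MeasureTheory.volume
        (m * τ) ((m + 1 : ℕ) * τ) :=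
      intervalIntegral.intervalIntegrable_rpow' (by linarith : -1 < -α)
    -- Both terms are written as integrals of `u^(-α)` over the same cell, with `Δ` against `τ G'`;
    -- the prefactor is the same because `τ^α τ^(1-α) = τ`.
    have hi1 : ((β / Real.Gamma (2 - α) : ℝ) : ℂ) * Δ
        = ((τ ^ α / (τ * Real.Gamma (1 - α)) : ℝ) : ℂ) * ∫ u in (m * τ)..((m + 1 : ℕ) * τ),
          ((u ^ (-α) : ℝ) : ℂ) * Δ := by
      rw [intervalIntegral.integral_mul_const, intervalIntegral.integral_ofReal, hcellint,
        ← mul_assoc, ← Complex.ofReal_mul]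
      congr 2
      rw [e]
      calc β / ((1 - α) * Real.Gamma (1 - α))
          = (τ) / (τ * Real.Gamma (1 - α)) * (β / (1 - α)) := by field_simp
        _ = (τ ^ α * τ ^ (1 - α)) / (τ * Real.Gamma (1 - α)) * (β / (1 - α)) := by rw [hττ]
        _ = _ := by ring
    have hi2 : ((τ ^ α : ℝ) : ℂ) * ((1 / (Real.Gamma (1 - α) : ℂ)) *
        ∫ u in (m * τ)..((m + 1 : ℕ) * τ), ((u ^ (-α) : ℝ) : ℂ) * G' (n * τ - u))
        = ((τ ^ α / (τ * Real.Gamma (1 - α)) : ℝ) : ℂ) * ∫ u in (m * τ)..((m + 1 : ℕ) * τ),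
          (τ : ℂ) * (((u ^ (-α) : ℝ) : ℂ) * G' (n * τ - u)) := by
      rw [intervalIntegral.integral_const_mul]
      have : (τ : ℂ) ≠ 0 := by exact_mod_cast hτ.ne'
      have : (Real.Gamma (1 - α) : ℂ) ≠ 0 := by exact_mod_cast hg.ne'
      push_cast
      field_simp
    have hgi : IntervalIntegrable (fun u : ℝ => C * τ ^ 2 * u ^ (-α)) MeasureTheory.volume
        (m * τ) ((m + 1 : ℕ) * τ) := hri.const_mul _
    rw [hi1, hi2, ← mul_sub, ← intervalIntegral.integral_sub ((intervalIntegrable_rpow_ofReal h1 _ _).mul_const _)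
      ((hint m hm).const_mul _), norm_mul, Complex.norm_real, Real.norm_of_nonneg (by positivity)]
    have hb : ‖∫ u in (m * τ)..((m + 1 : ℕ) * τ), (((u ^ (-α) : ℝ) : ℂ) * Δ
        - (τ : ℂ) * (((u ^ (-α) : ℝ) : ℂ) * G' (n * τ - u)))‖
        ≤ ∫ u in (m * τ)..((m + 1 : ℕ) * τ), C * τ ^ 2 * u ^ (-α) := by
      refine intervalIntegral.norm_integral_le_of_norm_le (hmle m) ?_ hgi
      refine Filter.Eventually.of_forall fun u hu => ?_
      have hu0 : 0 < u := lt_of_le_of_lt (by positivity) hu.1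
      have hu' : u ∈ Icc (m * τ) ((m + 1 : ℕ) * τ) := ⟨hu.1.le, hu.2⟩
      have c1 := hcell m hm _ (right_mem_Icc.2 (hmle m))
      have c2 := hcell m hm _ (left_mem_Icc.2 (hmle m))
      have := norm_sub_sub_smul_le hG hL hC (a := n * τ - (m + 1 : ℕ) * τ) (b := n * τ - m * τ)
        (s := n * τ - u) c1.1 (by linarith [hmle m]) c2.2
        ⟨by linarith [hu.2], by linarith [hu.1]⟩
      rw [show n * τ - m * τ - (n * τ - (m + 1 : ℕ) * τ) = τ by push_cast; ring, ← hΔ] at this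
      calc ‖((u ^ (-α) : ℝ) : ℂ) * Δ - (τ : ℂ) * (((u ^ (-α) : ℝ) : ℂ) * G' (n * τ - u))‖
          = ‖((u ^ (-α) : ℝ) : ℂ) * (Δ - (τ : ℂ) * G' (n * τ - u))‖ := by
            congr 1
            ring
        _ = u ^ (-α) * ‖Δ - (τ : ℂ) * G' (n * τ - u)‖ := by
            rw [norm_mul, Complex.norm_real, Real.norm_of_nonneg (by positivity)]
        _ ≤ u ^ (-α) * (C * τ ^ 2) := by gcongr
        _ = _ := by ring
    rw [intervalIntegral.integral_const_mul, hcellint] at hb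
    calc _ ≤ τ ^ α / (τ * Real.Gamma (1 - α)) * (C * τ ^ 2 * (τ ^ (1 - α) * (β / (1 - α)))) := by
          gcongr
      _ = (τ ^ α * τ ^ (1 - α)) * (C * τ ^ 2 / (τ * Real.Gamma (1 - α))) * (β / (1 - α)) := by ring
      _ = _ := by
          rw [hττ, e]
          field_simp
  have htel : ∑ m ∈ Finset.range n, (((m + 1 : ℕ) : ℝ) ^ (1 - α) - (m : ℝ) ^ (1 - α))
      = (n : ℝ) ^ (1 - α) := by
    rw [Finset.sum_range_sub (fun m : ℕ => (m : ℝ) ^ (1 - α))]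
    simp [Real.zero_rpow h1'.ne']
  unfold fracInt
  rw [hsum, Finset.mul_sum, Finset.mul_sum, ← Finset.sum_sub_distrib]
  refine (norm_sum_le_of_le _ hterm).trans (le_of_eq ?_)
  rw [← Finset.mul_sum, htel]
  ring

/-- The Grünwald formula for a function vanishing at the origin has a truncation error of first
order, with the weight `t_n^(-α)`. -/
theorem grunwald_truncation {α : ℝ} (h0 : 0 < α) (h1 : α < 1) {G G' : ℝ → ℂ} {T B C : ℝ}
    (hG0 : G 0 = 0) (hG : ∀ t ∈ Icc 0 T, HasDerivWithinAt G (G' t) (Icc 0 T) t)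
    (hB : ∀ t ∈ Icc 0 T, ‖G' t‖ ≤ B)
    (hL : ∀ s ∈ Icc 0 T, ∀ t ∈ Icc 0 T, ‖G' s - G' t‖ ≤ C * |s - t|) (hC : 0 ≤ C)
    (hc : ContinuousOn G' (Icc 0 T)) {τ : ℝ} (hτ : 0 < τ) {n : ℕ} (hn1 : 1 ≤ n)
    (hn : n * τ ≤ T) :
    ‖∑ k ∈ Finset.range (n + 1), (coeff α k : ℂ) * G ((n - k : ℕ) * τ)
      - (τ ^ α : ℝ) * fracInt α G' (n * τ)‖
      ≤ (B + C * T + 2 * C * T / (1 - α)) / Real.Gamma (2 - α) * (τ * (n : ℝ) ^ (-α)) := by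
  have h1' : 0 < 1 - α := by linarith
  have hg : 0 < Real.Gamma (2 - α) := Real.Gamma_pos_of_pos (by linarith)
  have hn0 : (0 : ℝ) < n := by exact_mod_cast hn1
  set x : ℕ → ℂ := fun m => G (n * τ - m * τ) with hx
  set Δ : ℕ → ℂ := fun m => x m - x (m + 1) with hΔ
  set β : ℕ → ℝ := fun m => (((m + 1 : ℕ) : ℝ) ^ (1 - α) - (m : ℝ) ^ (1 - α)) /
    Real.Gamma (2 - α) with hβ
  have hmem : ∀ m ≤ n, n * τ - m * τ ∈ Icc 0 T := by
    intro m hm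
    have : (m : ℝ) * τ ≤ n * τ := by gcongr
    have : 0 ≤ (m : ℝ) * τ := by positivity
    exact ⟨by linarith, by linarith⟩
  -- First Abel summation: the Grünwald weights turn into partial sums acting on increments of `G`,
  -- and the end term vanishes as `G 0 = 0`.
  have a1 : ∑ k ∈ Finset.range (n + 1), (coeff α k : ℂ) * G ((n - k : ℕ) * τ)
      = ∑ m ∈ Finset.range n, (coeffSum α m : ℂ) * Δ m := by
    have := abel_sum (coeff α) x n
    have hxn : x n = 0 := by simp [hx, hG0]
    rw [hxn, mul_zero, add_zero] at this
    rw [← show _ = ∑ m ∈ Finset.range n, (coeffSum α m : ℂ) * Δ m from this]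
    refine Finset.sum_congr rfl fun k hk => ?_
    rw [Finset.mem_range] at hk
    simp only [hx]
    rw [Nat.cast_sub (by omega), sub_mul]
  have a2 := fracInt_sub_sum_le h1 hG hL hC hc hτ hn
  have hΔ1 : ∀ m < n, ‖Δ m‖ ≤ B * τ := by
    intro m hm
    have := (convex_Icc 0 T).norm_image_sub_le_of_norm_hasDerivWithin_le hG hB
      (hmem (m + 1) hm) (hmem m hm.le)
    refine this.trans (le_of_eq ?_)
    rw [show n * τ - m * τ - (n * τ - (m + 1 : ℕ) * τ) = τ by push_cast; ring,
      Real.norm_of_nonneg hτ.le]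
  have hΔ2 : ∀ m, m + 1 < n → ‖Δ m - Δ (m + 1)‖ ≤ 2 * C * τ ^ 2 := by
    intro m hm
    have i1 := norm_sub_sub_smul_le hG hL hC (a := n * τ - (m + 1 : ℕ) * τ) (b := n * τ - m * τ)
      (s := n * τ - (m + 1 : ℕ) * τ) (hmem _ (by omega)).1 (by push_cast; linarith)
      (hmem _ (by omega)).2 ⟨le_rfl, by push_cast; linarith⟩
    have i2 := norm_sub_sub_smul_le hG hL hC (a := n * τ - (m + 1 + 1 : ℕ) * τ)
      (b := n * τ - (m + 1 : ℕ) * τ)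
      (s := n * τ - (m + 1 : ℕ) * τ) (hmem _ (by omega)).1 (by push_cast; linarith)
      (hmem _ (by omega)).2 ⟨by push_cast; linarith, le_rfl⟩
    rw [show n * τ - m * τ - (n * τ - (m + 1 : ℕ) * τ) = τ by push_cast; ring] at i1
    rw [show n * τ - (m + 1 : ℕ) * τ - (n * τ - (m + 1 + 1 : ℕ) * τ) = τ by push_cast; ring] at i2
    calc ‖Δ m - Δ (m + 1)‖
        = ‖(Δ m - τ * G' (n * τ - (m + 1 : ℕ) * τ))
            - (Δ (m + 1) - τ * G' (n * τ - (m + 1 : ℕ) * τ))‖ := by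
          congr 1
          ring
      _ ≤ C * τ ^ 2 + C * τ ^ 2 := (norm_sub_le _ _).trans (add_le_add i1 i2)
      _ = _ := by ring
  obtain ⟨p, rfl⟩ : ∃ p, n = p + 1 := ⟨n - 1, by omega⟩
  have hD : ∀ m : ℕ, |∑ i ∈ Finset.range (m + 1), (coeffSum α i - β i)|
      ≤ 1 / Real.Gamma (2 - α) * ((m : ℝ) + 1) ^ (-α) := by
    intro m
    have h := abs_sum_coeffSum_sub_le h0 h1 (n := m + 1) (by omega)
    rw [Finset.sum_sub_distrib]
    have hs : ∑ i ∈ Finset.range (m + 1), β i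
        = (((m + 1 : ℕ) : ℝ) ^ (1 - α)) / Real.Gamma (2 - α) := by
      simp only [hβ]
      rw [← Finset.sum_div, Finset.sum_range_sub (fun m : ℕ => (m : ℝ) ^ (1 - α))]
      simp [Real.zero_rpow h1'.ne']
    rw [hs]
    exact_mod_cast h
  -- Second Abel summation: partial sums of `A_m - β_m` are `O((m+1)^(-α))` and meet second
  -- differences of size `τ²`. The end term meets one increment of size `τ`, which is what limits
  -- the rate to `τ n^(-α)`.
  have a3 : ‖∑ m ∈ Finset.range (p + 1), ((coeffSum α m - β m : ℝ) : ℂ) * Δ m‖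
      ≤ ∑ m ∈ Finset.range p, 1 / Real.Gamma (2 - α) * ((m : ℝ) + 1) ^ (-α) * (2 * C * τ ^ 2)
        + 1 / Real.Gamma (2 - α) * ((p : ℝ) + 1) ^ (-α) * (B * τ) := by
    rw [abel_sum (fun m => coeffSum α m - β m) Δ p]
    refine (norm_add_le _ _).trans (add_le_add (norm_sum_le_of_le _ fun m hm => ?_) ?_)
    · rw [Finset.mem_range] at hm
      rw [norm_mul, Complex.norm_real, Real.norm_eq_abs]
      exact mul_le_mul (hD m) (hΔ2 m (by omega)) (norm_nonneg _) (by positivity)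
    · rw [norm_mul, Complex.norm_real, Real.norm_eq_abs]
      exact mul_le_mul (hD p) (hΔ1 p (by omega)) (norm_nonneg _) (by positivity)
  have a4 : ∑ m ∈ Finset.range (p + 1), (coeffSum α m : ℂ) * Δ m
      - (τ ^ α : ℝ) * fracInt α G' ((p + 1 : ℕ) * τ)
      = ∑ m ∈ Finset.range (p + 1), ((coeffSum α m - β m : ℝ) : ℂ) * Δ m
        + (∑ m ∈ Finset.range (p + 1), (β m : ℂ) * Δ m
          - (τ ^ α : ℝ) * fracInt α G' ((p + 1 : ℕ) * τ)) := by
    push_cast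
    simp only [sub_mul, Finset.sum_sub_distrib]
    ring
  rw [a1, a4]
  refine (norm_add_le _ _).trans ((add_le_add a3 a2).trans ?_)
  rw [← Finset.sum_mul, ← Finset.mul_sum]
  have hp := sum_rpow_neg_le h0 h1 p
  have hpp : (p : ℝ) ^ (1 - α) ≤ ((p + 1 : ℕ) : ℝ) ^ (1 - α) := by
    gcongr
    omega
  -- One factor `n τ ≤ T` turns `n^(1-α) τ²` into `T τ n^(-α)`.
  have hτn : ((p + 1 : ℕ) : ℝ) ^ (1 - α) * τ ^ 2 ≤ T * (τ * ((p + 1 : ℕ) : ℝ) ^ (-α)) := by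
    rw [show 1 - α = -α + 1 by ring, Real.rpow_add_one hn0.ne']
    have : 0 ≤ τ * ((p + 1 : ℕ) : ℝ) ^ (-α) := by positivity
    nlinarith
  have e1 : ((p : ℝ) + 1) = ((p + 1 : ℕ) : ℝ) := by push_cast; rfl
  rw [e1]
  set X := ((p + 1 : ℕ) : ℝ) ^ (-α)
  set Z := ((p + 1 : ℕ) : ℝ) ^ (1 - α)
  set g := Real.Gamma (2 - α)
  calc 1 / g * (∑ i ∈ Finset.range p, ((i : ℝ) + 1) ^ (-α)) * (2 * C * τ ^ 2)
        + 1 / g * X * (B * τ) + C * Z / g * τ ^ 2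
      ≤ 1 / g * (Z / (1 - α)) * (2 * C * τ ^ 2) + 1 / g * X * (B * τ) + C * Z / g * τ ^ 2 := by
        have := hp.trans (div_le_div_of_nonneg_right hpp h1'.le)
        gcongr
    _ = (2 * C / (1 - α) / g + C / g) * (Z * τ ^ 2) + 1 / g * X * (B * τ) := by ring
    _ ≤ (2 * C / (1 - α) / g + C / g) * (T * (τ * X)) + 1 / g * X * (B * τ) := by gcongr
    _ = _ := by ring

/-! ### The Caputo fractional substantial derivative -/

/-- Extension of a function on `[0, T]` by zero to the left and by its end value to the right. -/
noncomputable def zeroExt {T : ℝ} (hT : 0 ≤ T) (g : ℝ → ℂ) (s : ℝ) : ℂ :=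
  if s ≤ 0 then 0 else g (projIcc 0 T hT s)

section ZeroExt

variable {T : ℝ} (hT : 0 ≤ T) {g : ℝ → ℂ}

theorem continuous_comp_projIcc (hg : ContinuousOn g (Icc 0 T)) :
    Continuous fun s => g (projIcc 0 T hT s) :=
  (continuousOn_iff_continuous_domRestrict.1 hg).comp continuous_projIcc

/-- The origin is excluded because the extension jumps there unless `g 0 = 0`. -/
theorem continuousAt_zeroExt (hg : ContinuousOn g (Icc 0 T)) {s : ℝ} (hs : s ≠ 0) :
    ContinuousAt (zeroExt hT g) s := by
  rcases lt_or_gt_of_ne hs with h | h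
  · refine continuousAt_const.congr (f := fun _ => (0 : ℂ)) ?_
    filter_upwards [Iio_mem_nhds h] with x hx
    simp only [zeroExt]
    rw [if_pos (le_of_lt hx)]
  · refine ((continuous_comp_projIcc hT hg).continuousAt).congr ?_
    filter_upwards [Ioi_mem_nhds h] with x hx
    simp only [zeroExt]
    rw [if_neg (not_le.2 hx)]

theorem stronglyMeasurable_zeroExt (hg : ContinuousOn g (Icc 0 T)) :
    MeasureTheory.StronglyMeasurable (zeroExt hT g) :=
  MeasureTheory.StronglyMeasurable.ite measurableSet_Iic
    MeasureTheory.stronglyMeasurable_const (continuous_comp_projIcc hT hg).stronglyMeasurable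

theorem zeroExt_of_mem {s : ℝ} (h0 : 0 < s) (h1 : s ≤ T) : zeroExt hT g s = g s := by
  unfold zeroExt
  rw [if_neg (not_le.2 h0), projIcc_of_mem hT ⟨h0.le, h1⟩]

theorem norm_zeroExt_le {B : ℝ} (hB : ∀ t ∈ Icc 0 T, ‖g t‖ ≤ B) (s : ℝ) :
    ‖zeroExt hT g s‖ ≤ B := by
  unfold zeroExt
  split_ifs
  · rw [norm_zero]
    exact (norm_nonneg _).trans (hB 0 ⟨le_rfl, hT⟩)
  · exact hB _ (projIcc 0 T hT s).2

theorem intervalIntegrable_zeroExt (hg : ContinuousOn g (Icc 0 T)) {B : ℝ}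
    (hB : ∀ t ∈ Icc 0 T, ‖g t‖ ≤ B) (a b : ℝ) :
    IntervalIntegrable (zeroExt hT g) MeasureTheory.volume a b :=
  (intervalIntegrable_const (c := B)).mono_fun
    (stronglyMeasurable_zeroExt hT hg).aestronglyMeasurable
    (Filter.Eventually.of_forall fun s => (norm_zeroExt_le hT hB s).trans (le_abs_self B))

end ZeroExt

/-- Differentiation of the Riemann-Liouville integral of a function vanishing at the origin. -/
theorem hasDerivWithinAt_fracInt {α : ℝ} (h1 : α < 1) {G G' : ℝ → ℂ} {T B : ℝ}
    (hG0 : G 0 = 0) (hG : ∀ t ∈ Icc 0 T, HasDerivWithinAt G (G' t) (Icc 0 T) t)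
    (hB : ∀ t ∈ Icc 0 T, ‖G' t‖ ≤ B) (hc : ContinuousOn G' (Icc 0 T)) {t : ℝ}
    (ht : t ∈ Ioc 0 T) : HasDerivWithinAt (fracInt α G) (fracInt α G' t) (Icc 0 T) t := by
  have hT : 0 ≤ T := ht.1.le.trans ht.2
  have hB0 : 0 ≤ B := (norm_nonneg _).trans (hB 0 ⟨le_rfl, hT⟩)
  set D := zeroExt hT G' with hD
  have hDi := intervalIntegrable_zeroExt hT hc hB
  have hDm := stronglyMeasurable_zeroExt hT hc
  -- `E` extends `G` to a globally Lipschitz function vanishing on the negative axis. The upper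
  -- limit of the convolution can then be fixed at `T + 1`, and one differentiates under the
  -- integral with the integrable bound `B u^(-α)`.
  set E : ℝ → ℂ := fun s => ∫ y in (0 : ℝ)..s, D y with hE
  have hEd : ∀ s, s ≠ 0 → HasDerivAt E (D s) s := fun s hs =>
    intervalIntegral.integral_hasDerivAt_right (hDi _ _) (hDm.stronglyMeasurableAtFilter)
      (continuousAt_zeroExt hT hc hs)
  have hEl : ∀ x y, ‖E x - E y‖ ≤ B * |x - y| := by
    intro x y
    rw [hE]
    simp only
    rw [intervalIntegral.integral_interval_sub_left (hDi _ _) (hDi _ _)]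
    exact intervalIntegral.norm_integral_le_of_norm_le_const
      fun s _ => norm_zeroExt_le hT hB s
  have hEc : Continuous E := by
    refine (LipschitzWith.of_dist_le_mul (K := ⟨B, hB0⟩) fun x y => ?_).continuous
    rw [dist_eq_norm, Real.dist_eq]
    exact hEl x y
  have hE0 : ∀ s ≤ 0, E s = 0 := by
    intro s hs
    rw [hE]
    simp only
    rw [intervalIntegral.integral_congr (g := fun _ => 0)]
    · simp
    · intro y hy
      rw [uIcc_of_ge hs] at hy
      simp only [hD, zeroExt]
      rw [if_pos hy.2]
  have hEG : ∀ s ∈ Icc 0 T, E s = G s := by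
    intro s hs
    rw [hE]
    simp only
    rw [intervalIntegral.integral_eq_sub_of_hasDerivAt_of_le hs.1 (f := G) ?_ ?_ (hDi _ _), hG0,
      sub_zero]
    · exact fun y hy => ((hG y ⟨hy.1, hy.2.trans hs.2⟩).continuousWithinAt).mono
        (Icc_subset_Icc_right hs.2)
    · intro y hy
      have hy2 : y < T := hy.2.trans_le hs.2
      rw [zeroExt_of_mem hT hy.1 hy2.le]
      exact (hG y ⟨hy.1.le, hy2.le⟩).hasDerivAt (Icc_mem_nhds hy.1 hy2)
  have hw := fun a b => intervalIntegrable_rpow_ofReal h1 a b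
  have hkey := intervalIntegral.hasDerivAt_integral_of_dominated_loc_of_lip
    (μ := MeasureTheory.volume) (a := 0) (b := T + 1) (x₀ := t) (s := univ)
    (F := fun x u => ((u ^ (-α) : ℝ) : ℂ) * E (x - u))
    (F' := fun u => ((u ^ (-α) : ℝ) : ℂ) * D (t - u))
    (bound := fun u => u ^ (-α) * B) Filter.univ_mem ?_ ?_ ?_ ?_ ?_ ?_
  · have hcut : ∀ x ∈ Icc 0 T, ∫ u in (0 : ℝ)..(T + 1), ((u ^ (-α) : ℝ) : ℂ) * E (x - u)
        = ∫ u in (0 : ℝ)..x, ((u ^ (-α) : ℝ) : ℂ) * G (x - u) := by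
      intro x hx
      have hi : ∀ a b, IntervalIntegrable (fun u => ((u ^ (-α) : ℝ) : ℂ) * E (x - u))
          MeasureTheory.volume a b := fun a b =>
        (hw a b).mul_continuousOn (by fun_prop)
      rw [← intervalIntegral.integral_add_adjacent_intervals (hi 0 x) (hi x (T + 1))]
      have z : ∫ u in x..(T + 1), ((u ^ (-α) : ℝ) : ℂ) * E (x - u) = 0 := by
        rw [intervalIntegral.integral_congr (g := fun _ => 0)]
        · simp
        · intro u hu
          rw [uIcc_of_le (by linarith [hx.2])] at hu
          simp only
          rw [hE0 _ (by linarith [hu.1]), mul_zero]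
      rw [z, add_zero]
      refine intervalIntegral.integral_congr fun u hu => ?_
      rw [uIcc_of_le hx.1] at hu
      rw [hEG _ ⟨by linarith [hu.2], by linarith [hu.1, hx.2]⟩]
    have hcut' : ∫ u in (0 : ℝ)..(T + 1), ((u ^ (-α) : ℝ) : ℂ) * D (t - u)
        = ∫ u in (0 : ℝ)..t, ((u ^ (-α) : ℝ) : ℂ) * G' (t - u) := by
      have i1 : IntervalIntegrable (fun u => ((u ^ (-α) : ℝ) : ℂ) * D (t - u))
          MeasureTheory.volume 0 t :=
        hkey.1.mono_set (by
          rw [uIcc_of_le ht.1.le, uIcc_of_le (by linarith)]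
          exact Icc_subset_Icc_right (by linarith [ht.2]))
      have i2 : IntervalIntegrable (fun u => ((u ^ (-α) : ℝ) : ℂ) * D (t - u))
          MeasureTheory.volume t (T + 1) :=
        hkey.1.mono_set (by
          rw [uIcc_of_le (by linarith [ht.2]), uIcc_of_le (by linarith)]
          exact Icc_subset_Icc_left ht.1.le)
      rw [← intervalIntegral.integral_add_adjacent_intervals i1 i2]
      have z : ∫ u in t..(T + 1), ((u ^ (-α) : ℝ) : ℂ) * D (t - u) = 0 := by
        rw [intervalIntegral.integral_congr (g := fun _ => 0)]
        · simp
        · intro u hu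
          rw [uIcc_of_le (by linarith [ht.2])] at hu
          simp only [hD, zeroExt]
          rw [if_pos (by linarith [hu.1]), mul_zero]
      rw [z, add_zero]
      refine intervalIntegral.integral_congr_Ioo_of_le ht.1.le fun u hu => ?_
      rw [hD, zeroExt_of_mem hT (by linarith [hu.2]) (by linarith [hu.1, ht.2])]
    have h2 := hkey.2
    rw [hcut'] at h2
    have h3 := (h2.hasDerivWithinAt (s := Icc 0 T)).congr (fun x hx => (hcut x hx).symm)
      (hcut t ⟨ht.1.le, ht.2⟩).symm
    exact h3.const_mul _
  · exact Filter.Eventually.of_forall fun x =>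
      ((hw 0 (T + 1)).mul_continuousOn (g := fun u => E (x - u))
        (by fun_prop)).def'.aestronglyMeasurable
  · exact (hw 0 (T + 1)).mul_continuousOn (by fun_prop)
  · refine MeasureTheory.AEStronglyMeasurable.mul (hw 0 (T + 1)).def'.aestronglyMeasurable ?_
    exact (hDm.comp_measurable (by fun_prop : Measurable fun u : ℝ => t - u)).aestronglyMeasurable
  · refine Filter.Eventually.of_forall fun u hu => ?_
    rw [uIoc_of_le (by linarith)] at hu
    have hu0 : 0 ≤ u ^ (-α) := Real.rpow_nonneg hu.1.le _
    refine LipschitzOnWith.of_dist_le_mul fun x _ y _ => ?_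
    rw [Real.coe_nnabs, abs_of_nonneg (mul_nonneg hu0 hB0), dist_eq_norm, ← mul_sub, norm_mul,
      Complex.norm_real, Real.norm_of_nonneg hu0, mul_assoc]
    refine mul_le_mul_of_nonneg_left ?_ hu0
    have := hEl (x - u) (y - u)
    rwa [sub_sub_sub_cancel_right, ← Real.dist_eq] at this
  · exact (intervalIntegral.intervalIntegrable_rpow' (by linarith : -1 < -α)).mul_const B
  · have hne : ∀ᵐ u : ℝ, u ≠ t := by
      simp [MeasureTheory.ae_iff]
    filter_upwards [hne] with u hu _
    have h := (hEd (t - u) (sub_ne_zero.2 hu.symm)).comp_sub_const t u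
    exact h.const_mul _

/-- The Caputo fractional substantial derivative as a conjugated Caputo derivative. -/
theorem caputoSubst_eq {α : ℝ} (h1 : α < 1) {ρ : ℂ} {p G' : ℝ → ℂ} {T B : ℝ}
    (hG : ∀ t ∈ Icc 0 T, HasDerivWithinAt
      (fun t : ℝ => Complex.exp (ρ * t) * p t - p 0) (G' t) (Icc 0 T) t)
    (hB : ∀ t ∈ Icc 0 T, ‖G' t‖ ≤ B) (hc : ContinuousOn G' (Icc 0 T)) {t : ℝ}
    (ht : t ∈ Ioc 0 T) :
    caputoSubst T α ρ 1 p t = Complex.exp (-ρ * t) * fracInt α G' t := by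
  set G : ℝ → ℂ := fun t => Complex.exp (ρ * t) * p t - p 0 with hGdef
  have hfl : ⌊α⌋₊ = 0 := Nat.floor_eq_zero.2 h1
  have hexp : ∀ t : ℝ, Complex.exp (-ρ * t) * Complex.exp (ρ * t) = 1 := by
    intro t
    rw [← Complex.exp_add]
    simp
  -- The identity `e^{-ρ(t-s)} (p(s) - e^{-ρs} p(0)) = e^{-ρt} G(s)` pulls the exponential out; then
  -- `∂/∂t + ρ` acts on `e^{-ρt} F` as `e^{-ρt} F'`.
  have hint : substInt (1 - α) ρ 1 (fun t => p t - Complex.exp (-ρ * (1 : ℝ) * t) * p 0)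
      = fun t : ℝ => Complex.exp (-ρ * t) * fracInt α G t := by
    ext x
    unfold substInt fracInt
    rw [mul_left_comm]
    congr 1
    rw [← intervalIntegral.integral_const_mul]
    have := intervalIntegral.integral_comp_sub_left (a := 0) (b := x)
      (fun u => Complex.exp (-ρ * x) * (((u ^ (-α) : ℝ) : ℂ) * G (x - u))) x
    rw [sub_self, sub_zero] at this
    rw [← this]
    refine intervalIntegral.integral_congr fun s _ => ?_
    simp only [hGdef, sub_sub_cancel]
    rw [show 1 - α - 1 = -α by ring]
    have e1 : Complex.exp (-ρ * (1 : ℝ) * (x - s)) = Complex.exp (-ρ * x) * Complex.exp (ρ * s) := by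
      rw [← Complex.exp_add]
      congr 1
      push_cast
      ring
    have e2 : Complex.exp (-ρ * (1 : ℝ) * s) = Complex.exp (-ρ * s) := by
      congr 1
      push_cast
      ring
    rw [e1, e2]
    linear_combination (-((x - s) ^ (-α) : ℝ) * Complex.exp (-ρ * x) * p 0) * hexp s
  have hG0 : G 0 = 0 := by simp [hGdef]
  have hd := hasDerivWithinAt_fracInt h1 hG0 hG hB hc ht
  have he : HasDerivWithinAt (fun t : ℝ => Complex.exp (-ρ * t))
      (Complex.exp (-ρ * t) * (-ρ)) (Icc 0 T) t := by
    have h := (((hasDerivAt_id t).ofReal_comp.const_mul (-ρ)).cexp).hasDerivWithinAt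
      (s := Icc 0 T)
    simpa using h
  have hT : 0 < T := ht.1.trans_le ht.2
  have hu : UniqueDiffWithinAt ℝ (Icc 0 T) t := uniqueDiffOn_Icc hT t ⟨ht.1.le, ht.2⟩
  unfold caputoSubst substDeriv
  rw [hfl]
  simp only [zero_add, Function.iterate_one, Nat.cast_one]
  rw [hint]
  unfold substOp
  rw [(he.fun_mul hd).derivWithin hu]
  push_cast
  ring

/-! ### Truncation error of the compact second difference -/

/-- Induction by the mean value inequality: the remainder of order `n + 1` has as derivative the
remainder of order `n` of `F 1`. The factor `1/n!` is given up. -/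
theorem norm_sub_taylor_sum_le {a b C : ℝ} (n : ℕ) (F : ℕ → ℝ → ℂ)
    (hF : ∀ k < n, ∀ x ∈ Icc a b, HasDerivWithinAt (F k) (F (k + 1) x) (Icc a b) x)
    (hC : ∀ x ∈ Icc a b, ‖F n x‖ ≤ C) :
    ∀ x ∈ Icc a b, ‖F 0 x - ∑ k ∈ Finset.range n, ((x - a) ^ k / k.factorial : ℝ) * F k a‖
      ≤ C * (x - a) ^ n := by
  induction n generalizing F with
  | zero =>
    intro x hx
    simpa using hC x hx
  | succ n ih =>
    intro x hx
    have hsub : Icc a x ⊆ Icc a b := Icc_subset_Icc_right hx.2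
    have hC0 : 0 ≤ C := (norm_nonneg _).trans (hC x hx)
    have ih' := ih (fun k => F (k + 1)) (fun k hk y hy => hF (k + 1) (by omega) y hy) hC
    have hd : ∀ y ∈ Icc a x, HasDerivWithinAt (fun y => F 0 y
        - ∑ k ∈ Finset.range (n + 1), ((y - a) ^ k / k.factorial : ℝ) * F k a)
        (F 1 y - ∑ k ∈ Finset.range n, ((y - a) ^ k / k.factorial : ℝ) * F (k + 1) a)
        (Icc a x) y := by
      intro y hy
      refine ((hF 0 (by omega) y (hsub hy)).mono hsub).sub ?_
      have e : (fun y : ℝ => ∑ k ∈ Finset.range (n + 1),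
          (((y - a) ^ k / k.factorial : ℝ) : ℂ) * F k a)
          = fun y : ℝ => ∑ k ∈ Finset.range n,
            (((y - a) ^ (k + 1) / (k + 1).factorial : ℝ) : ℂ) * F (k + 1) a + F 0 a := by
        ext y
        rw [Finset.sum_range_succ']
        simp
      rw [e]
      refine (HasDerivWithinAt.fun_sum fun k _ => ?_).add_const _
      refine HasDerivWithinAt.mul_const ?_ _
      refine HasDerivAt.hasDerivWithinAt (HasDerivAt.ofReal_comp ?_)
      have h := ((((hasDerivAt_id y).sub_const a).fun_pow (k + 1)).div_const
        ((k + 1).factorial : ℝ))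
      refine h.congr_deriv ?_
      rw [Nat.factorial_succ]
      have : (k.factorial : ℝ) ≠ 0 := by positivity
      push_cast
      simp only [id]
      field_simp
    have h := (convex_Icc a x).norm_image_sub_le_of_norm_hasDerivWithin_le
      (C := C * (x - a) ^ n) hd (fun y hy => ?_) (left_mem_Icc.2 hx.1) (right_mem_Icc.2 hx.1)
    · have z : F 0 a - ∑ k ∈ Finset.range (n + 1),
          (((a - a) ^ k / k.factorial : ℝ) : ℂ) * F k a = 0 := by
        rw [Finset.sum_range_succ']
        simp
      rw [z, sub_zero, Real.norm_of_nonneg (by linarith [hx.1])] at h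
      refine h.trans (le_of_eq ?_)
      ring
    · refine (ih' y (hsub hy)).trans ?_
      have := hy.1
      have := hy.2
      gcongr

theorem compact_truncation {a b C h : ℝ} (F : ℕ → ℝ → ℂ)
    (hF : ∀ k < 6, ∀ x ∈ Icc a b, HasDerivWithinAt (F k) (F (k + 1) x) (Icc a b) x)
    (hC : ∀ x ∈ Icc a b, ‖F 6 x‖ ≤ C) (hh : 0 < h) {x : ℝ} (hx1 : a ≤ x - h) (hx2 : x + h ≤ b) :
    ‖(F 2 (x + h) + 10 * F 2 x + F 2 (x - h)) / 12
      - (F 0 (x + h) - 2 * F 0 x + F 0 (x - h)) / (h : ℂ) ^ 2‖ ≤ 69 * C * h ^ 4 := by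
  have hsub : Icc (x - h) b ⊆ Icc a b := Icc_subset_Icc_left hx1
  have hC' : ∀ y ∈ Icc (x - h) b, ‖F 6 y‖ ≤ C := fun y hy => hC y (hsub hy)
  have m1 : x ∈ Icc (x - h) b := ⟨by linarith, by linarith⟩
  have m2 : x + h ∈ Icc (x - h) b := ⟨by linarith, by linarith⟩
  have hC0 : 0 ≤ C := (norm_nonneg _).trans (hC' x m1)
  have t0 := norm_sub_taylor_sum_le 6 F
    (fun k hk y hy => (hF k hk y (hsub hy)).mono hsub) hC'
  have t2 := norm_sub_taylor_sum_le 4 (fun k => F (k + 2))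
    (fun k hk y hy => (hF (k + 2) (by omega) y (hsub hy)).mono hsub) hC'
  have a1 := t0 x m1
  have a2 := t0 (x + h) m2
  have b1 := t2 x m1
  have b2 := t2 (x + h) m2
  rw [show x - (x - h) = h by ring] at a1 b1
  rw [show x + h - (x - h) = 2 * h by ring] at a2 b2
  simp only [Finset.sum_range_succ, Finset.sum_range_zero, Nat.factorial] at a1 a2 b1 b2
  set A := x - h
  have hh' : (h : ℂ) ≠ 0 := by exact_mod_cast hh.ne'
  obtain ⟨R1, e1, c1⟩ : ∃ R, F 0 x = _ + R ∧ ‖R‖ ≤ C * h ^ 6 :=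
    ⟨_, (add_sub_cancel _ _).symm, a1⟩
  obtain ⟨R2, e2, c2⟩ : ∃ R, F 0 (x + h) = _ + R ∧ ‖R‖ ≤ C * (2 * h) ^ 6 :=
    ⟨_, (add_sub_cancel _ _).symm, a2⟩
  obtain ⟨S1, f1, d1⟩ : ∃ R, F 2 x = _ + R ∧ ‖R‖ ≤ C * h ^ 4 :=
    ⟨_, (add_sub_cancel _ _).symm, b1⟩
  obtain ⟨S2, f2, d2⟩ : ∃ R, F 2 (x + h) = _ + R ∧ ‖R‖ ≤ C * (2 * h) ^ 4 :=
    ⟨_, (add_sub_cancel _ _).symm, b2⟩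
  -- All expansions start from the left node `A = x - h`, so they are one-sided. The Taylor
  -- polynomials, up to degree five for `F 0` and three for `F 2`, cancel exactly.
  have key : (F 2 (x + h) + 10 * F 2 x + F 2 A) / 12
      - (F 0 (x + h) - 2 * F 0 x + F 0 A) / (h : ℂ) ^ 2
      = ((1 / 12 : ℝ) : ℂ) * S2 + ((10 / 12 : ℝ) : ℂ) * S1
        - (((1 / h ^ 2 : ℝ) : ℂ) * R2 - ((2 / h ^ 2 : ℝ) : ℂ) * R1) := by
    rw [e1, e2, f1, f2]
    push_cast
    field_simp
    ring
  rw [key]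
  have n1 : ‖((1 / 12 : ℝ) : ℂ) * S2‖ ≤ 1 / 12 * (C * (2 * h) ^ 4) := by
    rw [norm_mul, Complex.norm_real, Real.norm_of_nonneg (by norm_num)]
    gcongr
  have n2 : ‖((10 / 12 : ℝ) : ℂ) * S1‖ ≤ 10 / 12 * (C * h ^ 4) := by
    rw [norm_mul, Complex.norm_real, Real.norm_of_nonneg (by norm_num)]
    gcongr
  have n3 : ‖((1 / h ^ 2 : ℝ) : ℂ) * R2‖ ≤ 1 / h ^ 2 * (C * (2 * h) ^ 6) := by
    rw [norm_mul, Complex.norm_real, Real.norm_of_nonneg (by positivity)]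
    gcongr
  have n4 : ‖((2 / h ^ 2 : ℝ) : ℂ) * R1‖ ≤ 2 / h ^ 2 * (C * h ^ 6) := by
    rw [norm_mul, Complex.norm_real, Real.norm_of_nonneg (by positivity)]
    gcongr
  have e3 : 1 / h ^ 2 * (C * (2 * h) ^ 6) = 64 * (C * h ^ 4) := by
    field_simp
    ring
  have e4 : 2 / h ^ 2 * (C * h ^ 6) = 2 * (C * h ^ 4) := by
    field_simp
  have hp : 0 ≤ C * h ^ 4 := by positivity
  -- The total is `16/12 + 10/12 + 64 + 2`, which is below `69`.
  calc _ ≤ (1 / 12 * (C * (2 * h) ^ 4) + 10 / 12 * (C * h ^ 4))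
        + (64 * (C * h ^ 4) + 2 * (C * h ^ 4)) := by
        refine (norm_sub_le _ _).trans (add_le_add ((norm_add_le _ _).trans (add_le_add n1 n2))
          ((norm_sub_le _ _).trans (add_le_add (n3.trans e3.le) (n4.trans e4.le))))
    _ ≤ _ := by nlinarith

theorem hasDerivWithinAt_iteratedDerivWithin {f : ℝ → ℂ} {a b : ℝ} (hab : a < b) {n k : ℕ}
    (hf : ContDiffOn ℝ n f (Icc a b)) (hk : k < n) {x : ℝ} (hx : x ∈ Icc a b) :
    HasDerivWithinAt (iteratedDerivWithin k f (Icc a b))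
      (iteratedDerivWithin (k + 1) f (Icc a b) x) (Icc a b) x := by
  rw [iteratedDerivWithin_succ]
  refine DifferentiableWithinAt.hasDerivWithinAt ?_
  exact hf.differentiableOn_iteratedDerivWithin (by exact_mod_cast hk) (uniqueDiffOn_Icc hab) x hx

/-! ### Regularity of the exact solution -/

theorem exists_bound_of_continuousOn {l T : ℝ} {g : ℝ × ℝ → ℂ}
    (hg : ContinuousOn g (Icc 0 l ×ˢ Icc 0 T)) :
    ∃ B, 0 ≤ B ∧ ∀ x ∈ Icc 0 l, ∀ t ∈ Icc 0 T, ‖g (x, t)‖ ≤ B := by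
  obtain ⟨B, hB⟩ := (isCompact_Icc.prod isCompact_Icc).exists_bound_of_continuousOn hg
  exact ⟨max B 0, le_max_right _ _, fun x hx t ht => (hB (x, t) ⟨hx, ht⟩).trans (le_max_left _ _)⟩

/-- The function `e^{ρt} P(x,t) - P(x,0)` has a time derivative that is jointly continuous,
bounded, and Lipschitz in time uniformly in `x`. -/
theorem exists_conj_deriv {l T : ℝ} (hT : 0 < T) (ρ : ℂ) {P : ℝ → ℝ → ℂ} {m : ℕ}
    (hreg : IsCxt m 2 l T P) :
    ∃ (G' : ℝ → ℝ → ℂ) (B C : ℝ), 0 ≤ B ∧ 0 ≤ C ∧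
      ContinuousOn (fun p : ℝ × ℝ => G' p.1 p.2) (Icc 0 l ×ˢ Icc 0 T) ∧
      ∀ x ∈ Icc 0 l,
        (∀ t ∈ Icc 0 T, HasDerivWithinAt (fun t : ℝ => Complex.exp (ρ * t) * P x t - P x 0)
          (G' x t) (Icc 0 T) t) ∧
        (∀ t ∈ Icc 0 T, ‖G' x t‖ ≤ B) ∧
        (∀ s ∈ Icc 0 T, ∀ t ∈ Icc 0 T, ‖G' x s - G' x t‖ ≤ C * |s - t|) := by
  set p : ℕ → ℝ → ℝ → ℂ := fun j x t => iteratedDerivWithin j (P x) (Icc 0 T) t with hp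
  have hc : ∀ j ≤ 2, ContinuousOn (fun q : ℝ × ℝ => p j q.1 q.2) (Icc 0 l ×ˢ Icc 0 T) :=
    fun j hj => hreg.continuous_t j hj
  have hexp : Continuous fun q : ℝ × ℝ => Complex.exp (ρ * q.2) := by fun_prop
  have hc1 : ContinuousOn (fun q : ℝ × ℝ =>
      Complex.exp (ρ * q.2) * (p 1 q.1 q.2 + ρ * p 0 q.1 q.2)) (Icc 0 l ×ˢ Icc 0 T) :=
    hexp.continuousOn.mul ((hc 1 (by omega)).add (continuousOn_const.mul (hc 0 (by omega))))
  have hc2 : ContinuousOn (fun q : ℝ × ℝ => Complex.exp (ρ * q.2) *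
      (p 2 q.1 q.2 + ρ * p 1 q.1 q.2 + ρ * (p 1 q.1 q.2 + ρ * p 0 q.1 q.2)))
      (Icc 0 l ×ˢ Icc 0 T) :=
    hexp.continuousOn.mul (((hc 2 le_rfl).add (continuousOn_const.mul (hc 1 (by omega)))).add
      (continuousOn_const.mul ((hc 1 (by omega)).add (continuousOn_const.mul (hc 0 (by omega))))))
  obtain ⟨B, hB0, hB⟩ := exists_bound_of_continuousOn hc1
  obtain ⟨C, hC0, hC⟩ := exists_bound_of_continuousOn hc2
  have he : ∀ t : ℝ, HasDerivWithinAt (fun t : ℝ => Complex.exp (ρ * t))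
      (Complex.exp (ρ * t) * ρ) (Icc 0 T) t := by
    intro t
    have h := (((hasDerivAt_id t).ofReal_comp.const_mul ρ).cexp).hasDerivWithinAt
      (s := Icc 0 T)
    simpa using h
  have hd : ∀ j < 2, ∀ x ∈ Icc 0 l, ∀ t ∈ Icc 0 T,
      HasDerivWithinAt (p j x) (p (j + 1) x t) (Icc 0 T) t := fun j hj x hx t ht =>
    hasDerivWithinAt_iteratedDerivWithin hT (hreg.contDiff_t x hx) hj ht
  refine ⟨fun x t => Complex.exp (ρ * t) * (p 1 x t + ρ * p 0 x t), B, C, hB0, hC0, hc1,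
    fun x hx => ⟨fun t ht => ?_, hB x hx, fun s hs t ht => ?_⟩⟩
  · have h := hd 0 (by omega) x hx t ht
    have e0 : p 0 x = P x := by
      ext t
      simp [hp]
    rw [e0] at h
    refine (((he t).fun_mul h).sub_const _).congr_deriv ?_
    simp only [e0]
    ring
  · have h := (convex_Icc 0 T).norm_image_sub_le_of_norm_hasDerivWithin_le
      (f := fun t : ℝ => Complex.exp (ρ * t) * (p 1 x t + ρ * p 0 x t)) (C := C)
      (fun t ht => ((he t).fun_mul ((hd 1 (by omega) x hx t ht).fun_add
        ((hd 0 (by omega) x hx t ht).const_mul ρ))).congr_deriv (by ring)) (hC x hx) ht hs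
    exact h

/-- Dominated convergence with the bound `B u^(-α)`. It serves to extend the equation to `x = 0` and
`x = l`, where averaging evaluates the source. -/
theorem continuousOn_fracInt {α : ℝ} (h1 : α < 1) {l T B : ℝ} {g : ℝ → ℝ → ℂ}
    (hg : ContinuousOn (fun p : ℝ × ℝ => g p.1 p.2) (Icc 0 l ×ˢ Icc 0 T))
    (hB : ∀ x ∈ Icc 0 l, ∀ t ∈ Icc 0 T, ‖g x t‖ ≤ B) {t : ℝ} (ht : t ∈ Icc 0 T) :
    ContinuousOn (fun x => fracInt α (g x) t) (Icc 0 l) := by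
  unfold fracInt
  refine continuousOn_const.mul fun x hx => ?_
  have hmem : ∀ u ∈ Icc 0 t, t - u ∈ Icc 0 T := fun u hu =>
    ⟨by linarith [hu.2], by linarith [hu.1, ht.2]⟩
  have hgx : ∀ x ∈ Icc 0 l, ContinuousOn (fun u => g x (t - u)) (uIcc 0 t) := by
    intro x hx
    rw [uIcc_of_le ht.1]
    exact hg.comp (f := fun u => (x, t - u)) (by fun_prop) fun u hu => ⟨hx, hmem u hu⟩
  refine intervalIntegral.continuousWithinAt_of_dominated_interval
    (bound := fun u => u ^ (-α) * B) ?_ ?_ ?_ ?_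
  · filter_upwards [self_mem_nhdsWithin] with y hy
    exact (intervalIntegrable_rpow_mul h1 (hgx y hy)).def'.aestronglyMeasurable
  · filter_upwards [self_mem_nhdsWithin] with y hy
    refine Filter.Eventually.of_forall fun u hu => ?_
    rw [uIoc_of_le ht.1] at hu
    have hu0 : 0 ≤ u ^ (-α) := Real.rpow_nonneg hu.1.le _
    rw [norm_mul, Complex.norm_real, Real.norm_of_nonneg hu0]
    exact mul_le_mul_of_nonneg_left (hB y hy _ (hmem u ⟨hu.1.le, hu.2⟩)) hu0
  · exact (intervalIntegral.intervalIntegrable_rpow' (by linarith : -1 < -α)).mul_const B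
  · refine Filter.Eventually.of_forall fun u hu => ?_
    rw [uIoc_of_le ht.1] at hu
    have : ContinuousOn (fun y => ((u ^ (-α) : ℝ) : ℂ) * g y (t - u)) (Icc 0 l) :=
      continuousOn_const.mul (hg.comp (f := fun y => (y, t - u)) (by fun_prop)
        fun y hy => ⟨hy, hmem u ⟨hu.1.le, hu.2⟩⟩)
    exact this x hx

theorem maxNorm_le {M : ℕ} {u : ℕ → ℂ} {c : ℝ} (hc : 0 ≤ c)
    (hu : ∀ i, 1 ≤ i → i ≤ M - 1 → ‖u i‖ ≤ c) : maxNorm M u ≤ c := by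
  unfold maxNorm
  have : (Finset.Icc 1 (M - 1)).sup (fun i => ‖u i‖₊) ≤ (⟨c, hc⟩ : NNReal) := by
    refine Finset.sup_le fun i hi => ?_
    rw [Finset.mem_Icc] at hi
    exact hu i hi.1 hi.2
  exact this

theorem eqOn_Icc_of_eqOn_Ioo {l : ℝ} (hl : 0 < l) {u v : ℝ → ℂ} (h : EqOn u v (Ioo 0 l))
    (hu : ContinuousOn u (Icc 0 l)) (hv : ContinuousOn v (Icc 0 l)) : EqOn u v (Icc 0 l) :=
  h.of_subset_closure hu hv Ioo_subset_Icc_self (by rw [closure_Ioo hl.ne])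

/-- The equation, solved for the source term, holds up to the boundary. -/
theorem source_eq {l T K α : ℝ} (hl : 0 < l) (h1 : α < 1) {ρ : ℂ}
    {f : ℝ → ℝ → ℂ} {φ ψ₁ ψ₂ : ℝ → ℂ} {P : ℝ → ℝ → ℂ}
    (hf : ∀ t ∈ Ioc 0 T, ContinuousOn (fun x => f x t) (Icc 0 l))
    (hP : IsSolution l T K α ρ (fun _ => 1) f φ ψ₁ ψ₂ P) (hreg : IsCxt 6 2 l T P)
    {G' : ℝ → ℝ → ℂ} {B : ℝ}
    (hc : ContinuousOn (fun p : ℝ × ℝ => G' p.1 p.2) (Icc 0 l ×ˢ Icc 0 T))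
    (hd : ∀ x ∈ Icc 0 l, ∀ t ∈ Icc 0 T, HasDerivWithinAt
      (fun t : ℝ => Complex.exp (ρ * t) * P x t - P x 0) (G' x t) (Icc 0 T) t)
    (hB : ∀ x ∈ Icc 0 l, ∀ t ∈ Icc 0 T, ‖G' x t‖ ≤ B) {t : ℝ} (ht : t ∈ Ioc 0 T) :
    ∀ x ∈ Icc 0 l, f x t = Complex.exp (-ρ * t) * fracInt α (G' x) t
      - K * iteratedDerivWithin 2 (fun y => P y t) (Icc 0 l) x := by
  have ht' : t ∈ Icc 0 T := ⟨ht.1.le, ht.2⟩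
  refine eqOn_Icc_of_eqOn_Ioo hl (fun x hx => ?_) (hf t ht) ?_
  · have hx' : x ∈ Icc 0 l := ⟨hx.1.le, hx.2.le⟩
    have hcx : ContinuousOn (G' x) (Icc 0 T) :=
      hc.comp (f := fun t => (x, t)) (by fun_prop) fun s hs => ⟨hx', hs⟩
    have h := hP.equation x hx t ht
    rw [caputoSubst_eq h1 (hd x hx') (hB x hx') hcx ht] at h
    rw [h]
    ring
  · refine (continuousOn_const.mul (continuousOn_fracInt h1 hc hB ht')).sub
      (continuousOn_const.mul ?_)
    exact (hreg.continuous_x 2 (by norm_num)).comp (f := fun x => (x, t)) (by fun_prop)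
      fun x hx => ⟨hx, ht'⟩

/-! ### The equation satisfied by the conjugated error -/

theorem conj_memory_sum (α : ℝ) (ρ : ℂ) (τ : ℝ) (q : ℕ → ℂ) (n : ℕ) :
    Complex.exp (ρ * (n * τ : ℝ)) * (∑ k ∈ Finset.range (n + 1), substCoeff α ρ 1 τ k * q (n - k)
      - ∑ k ∈ Finset.range (n + 1), substCoeff α ρ 1 τ k
          * Complex.exp (-ρ * (1 : ℝ) * ((n - k : ℕ) * τ)) * q 0)
      = ∑ k ∈ Finset.range (n + 1), (coeff α k : ℂ) *
        (Complex.exp (ρ * ((n - k : ℕ) * τ : ℝ)) * q (n - k) - q 0) := by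
  rw [← Finset.sum_sub_distrib, Finset.mul_sum]
  refine Finset.sum_congr rfl fun k hk => ?_
  have hk' : k ≤ n := by
    rw [Finset.mem_range] at hk
    omega
  have e1 : Complex.exp (ρ * (n * τ : ℝ)) * Complex.exp (-ρ * (1 : ℝ) * (k * τ))
      = Complex.exp (ρ * ((n - k : ℕ) * τ : ℝ)) := by
    rw [← Complex.exp_add]
    congr 1
    push_cast [Nat.cast_sub hk']
    ring
  have e2 : Complex.exp (ρ * ((n - k : ℕ) * τ : ℝ)) *
      Complex.exp (-ρ * (1 : ℝ) * ((n - k : ℕ) * τ)) = 1 := by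
    rw [← Complex.exp_add, Complex.exp_eq_one_iff]
    refine ⟨0, ?_⟩
    push_cast
    ring
  unfold substCoeff
  rw [← e1] at e2 ⊢
  linear_combination (-(coeff α k : ℂ) * q 0) * e2

/-- The residual of the exact solution in the compact scheme, multiplied by `e^{ρ t_n}`. -/
theorem error_equation {l T K α : ℝ} {ρ : ℂ} {f : ℝ → ℝ → ℂ} {φ ψ₁ ψ₂ : ℝ → ℂ}
    {P : ℝ → ℝ → ℂ} {M N : ℕ} {h τ : ℝ} {Q : ℕ → ℕ → ℂ}
    (hQ : IsSchemeSolution l T K α ρ (fun _ => 1) f φ ψ₁ ψ₂ M N h τ Q)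
    (h0 : ∀ j ≤ M, Q 0 j = P (j * h) 0) {n : ℕ} (hn1 : 1 ≤ n) (hnN : n ≤ N)
    {V D : ℝ → ℂ} (hf : ∀ j ≤ M, f (j * h) (n * τ)
      = Complex.exp (-ρ * (n * τ : ℝ)) * V (j * h) - K * D (j * h))
    {i : ℕ} (hi1 : 1 ≤ i) (hiM : i ≤ M - 1) {e : ℕ → ℕ → ℂ}
    (he : ∀ n i, e n i = Complex.exp (ρ * (n * τ : ℝ)) * (P (i * h) (n * τ) - Q n i))
    {R : ℝ → ℂ} (hR : ∀ x, R x = ∑ k ∈ Finset.range (n + 1), (coeff α k : ℂ) *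
      (Complex.exp (ρ * ((n - k : ℕ) * τ : ℝ)) * P x ((n - k : ℕ) * τ) - P x 0)
      - (τ ^ α : ℝ) * V x) :
    ∑ k ∈ Finset.range (n + 1), (coeff α k : ℂ) *
        ((e (n - k) (i + 1) + 10 * e (n - k) i + e (n - k) (i - 1)) / 12)
      = (K * τ ^ α / h ^ 2 : ℝ) * (e n (i + 1) - 2 * e n i + e n (i - 1))
        + ((R (i * h + h) + 10 * R (i * h) + R (i * h - h)) / 12
          + (K * τ ^ α : ℝ) * Complex.exp (ρ * (n * τ : ℝ)) *
            ((D (i * h + h) + 10 * D (i * h) + D (i * h - h)) / 12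
            - (P (i * h + h) (n * τ) - 2 * P (i * h) (n * τ) + P (i * h - h) (n * τ))
              / (h : ℂ) ^ 2)) := by
  obtain ⟨i, rfl⟩ : ∃ p, i = p + 1 := ⟨i - 1, by omega⟩
  have x1 : ((i + 1 : ℕ) : ℝ) * h + h = ((i + 1 + 1 : ℕ) : ℝ) * h := by
    push_cast
    ring
  have x2 : ((i + 1 : ℕ) : ℝ) * h - h = (i : ℝ) * h := by
    push_cast
    ring
  rw [x1, x2, Nat.add_sub_cancel]
  have hs := hQ.equation n (Finset.mem_Icc.2 ⟨hn1, hnN⟩) (i + 1) (Finset.mem_Icc.2 ⟨hi1, hiM⟩)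
  unfold compactOp secondDiff diffHalf at hs
  simp only [if_pos (show 1 ≤ i + 1 ∧ i + 1 ≤ M - 1 from ⟨hi1, hiM⟩), Nat.add_sub_cancel] at hs
  -- The memory sum of the error is that of the exact solution minus that of the scheme; the
  -- constants `P(x,0)` and `Q 0 j` subtracted inside them agree, and cancel.
  have hm : ∀ j ≤ M, ∑ k ∈ Finset.range (n + 1), (coeff α k : ℂ) * e (n - k) j
      = R (j * h) + (τ ^ α : ℝ) * V (j * h)
        - Complex.exp (ρ * (n * τ : ℝ)) *
          (∑ k ∈ Finset.range (n + 1), substCoeff α ρ 1 τ k * Q (n - k) j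
          - ∑ k ∈ Finset.range (n + 1), substCoeff α ρ 1 τ k
          * Complex.exp (-ρ * (1 : ℝ) * ((n - k : ℕ) * τ)) * Q 0 j) := by
    intro j hj
    rw [conj_memory_sum α ρ τ (fun n => Q n j) n, hR, sub_add_cancel, ← Finset.sum_sub_distrib]
    refine Finset.sum_congr rfl fun k _ => ?_
    rw [he, h0 j hj]
    ring
  have hsplit : ∑ k ∈ Finset.range (n + 1), (coeff α k : ℂ) *
        ((e (n - k) (i + 1 + 1) + 10 * e (n - k) (i + 1) + e (n - k) i) / 12)
      = (∑ k ∈ Finset.range (n + 1), (coeff α k : ℂ) * e (n - k) (i + 1 + 1)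
        + 10 * ∑ k ∈ Finset.range (n + 1), (coeff α k : ℂ) * e (n - k) (i + 1)
        + ∑ k ∈ Finset.range (n + 1), (coeff α k : ℂ) * e (n - k) i) / 12 := by
    rw [Finset.mul_sum, ← Finset.sum_add_distrib, ← Finset.sum_add_distrib, Finset.sum_div]
    refine Finset.sum_congr rfl fun k _ => ?_
    ring
  rw [hsplit, hm _ (by omega), hm _ (by omega), hm _ (by omega), he, he, he]
  rw [hf _ (by omega), hf _ (by omega), hf _ (by omega)] at hs
  have hexp : Complex.exp (ρ * (n * τ : ℝ)) * Complex.exp (-ρ * (n * τ : ℝ)) = 1 := by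
    rw [← Complex.exp_add]
    simp
  rw [Complex.ofReal_div, Complex.ofReal_mul K, Complex.ofReal_pow]
  set A : ℂ := ((τ ^ α : ℝ) : ℂ)
  linear_combination (-Complex.exp (ρ * (n * τ : ℝ))) * hs
    - A * ((V ((i + 1 + 1 : ℕ) * h) + 10 * V ((i + 1 : ℕ) * h) + V (i * h)) / 12) * hexp

end FeynmanKac

/-! ### Convergence: consistency combined with stability -/

theorem theorem3p2 (l T K α : ℝ) (hl : 0 < l) (hT : 0 < T) (hK : 0 < K)
    (hα : α ∈ Set.Ioo (0 : ℝ) 1) (ρ : ℂ) (hρ : 0 < ρ.re)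
    (f : ℝ → ℝ → ℂ) (φ ψ₁ ψ₂ : ℝ → ℂ) (P : ℝ → ℝ → ℂ)
    (hf : ∀ t ∈ Set.Ioc 0 T, ContinuousOn (fun x => f x t) (Set.Icc 0 l))
    (hφ : ContinuousOn φ (Set.Icc 0 l))
    (hP : FeynmanKac.IsSolution l T K α ρ (fun _ => 1) f φ ψ₁ ψ₂ P)
    (hreg : FeynmanKac.IsCxt 6 2 l T P) :
    ∃ C : ℝ, 0 < C ∧ ∀ M N : ℕ, 1 ≤ M → 1 ≤ N → ∀ h τ : ℝ, h = l / M → τ = T / N →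
      ∀ Q : ℕ → ℕ → ℂ,
        FeynmanKac.IsSchemeSolution l T K α ρ (fun _ => 1) f φ ψ₁ ψ₂ M N h τ Q →
        ∀ n ≤ N, FeynmanKac.maxNorm M (fun i => P (i * h) (n * τ) - Q n i)
          ≤ C * (τ + h ^ 4) := by

  obtain ⟨h0, h1⟩ := hα
  have h1' : 0 < 1 - α := by linarith
  have hg1 := Real.Gamma_pos_of_pos h1'
  have hg2 : 0 < Real.Gamma (2 - α) := Real.Gamma_pos_of_pos (by linarith)
  obtain ⟨G', B, C, hB0, hC0, hGc, hG⟩ := FeynmanKac.exists_conj_deriv hT ρ hreg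
  obtain ⟨S, hS0, hS⟩ := FeynmanKac.exists_bound_of_continuousOn (hreg.continuous_x 6 le_rfl)
  -- The initial condition is posed on the open interval; continuity carries it to the two corners,
  -- whose values the scheme takes from `φ`.
  have hini : ∀ x ∈ Set.Icc 0 l, P x 0 = φ x :=
    FeynmanKac.eqOn_Icc_of_eqOn_Ioo hl hP.initial
      (hreg.contDiff_x 0 ⟨le_rfl, hT.le⟩).continuousOn hφ
  set C3 := (B + C * T + 2 * C * T / (1 - α)) / Real.Gamma (2 - α) with hC3
  set C4 := C3 + K * T ^ α * Real.exp (ρ.re * T) * (69 * S) with hC4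
  have hC30 : 0 ≤ C3 := by positivity
  have hC40 : 0 ≤ C4 := by positivity
  have hkb := FeynmanKac.kernelBound_pos
  -- The extra factor is the inverse of the constant in `le_coeffSum`; it converts `n^(-α)` into the
  -- partial sum `A_n`.
  set Y0 := C4 * (Real.Gamma (1 - α) / (1 - α)) with hY0
  have hY00 : 0 ≤ Y0 := by positivity
  -- Adding `1` makes the constant positive even when `Y0 = 0`.
  refine ⟨FeynmanKac.kernelBound * Y0 + 1, by positivity, ?_⟩
  intro M N hM hN h τ hh hτ Q hQ n hn
  have hM0 : (0 : ℝ) < M := by exact_mod_cast hM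
  have hN0 : (0 : ℝ) < N := by exact_mod_cast hN
  have hh0 : 0 < h := by rw [hh]; positivity
  have hτ0 : 0 < τ := by rw [hτ]; positivity
  have hMh : (M : ℝ) * h = l := by rw [hh]; field_simp
  have hNτ : (N : ℝ) * τ = T := by rw [hτ]; field_simp
  have hxmem : ∀ j ≤ M, (j : ℝ) * h ∈ Set.Icc 0 l := fun j hj => by
    refine ⟨by positivity, ?_⟩
    rw [← hMh]
    gcongr
  have htmem : ∀ n, 1 ≤ n → n ≤ N → (n : ℝ) * τ ∈ Set.Ioc 0 T := fun n hn1 hnN => by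
    have : (0 : ℝ) < n := by exact_mod_cast hn1
    refine ⟨by positivity, ?_⟩
    rw [← hNτ]
    gcongr
  have hQ0 : ∀ j ≤ M, Q 0 j = P (j * h) 0 := fun j hj => by
    rw [hQ.initial j (Finset.mem_Icc.2 ⟨by omega, hj⟩), hini _ (hxmem j hj)]
  set e : ℕ → ℕ → ℂ := fun n i =>
    Complex.exp (ρ * (n * τ : ℝ)) * (P (i * h) (n * τ) - Q n i) with he
  set R : ℕ → ℝ → ℂ := fun n x => ∑ k ∈ Finset.range (n + 1), (FeynmanKac.coeff α k : ℂ) *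
      (Complex.exp (ρ * ((n - k : ℕ) * τ : ℝ)) * P x ((n - k : ℕ) * τ) - P x 0)
      - (τ ^ α : ℝ) * FeynmanKac.fracInt α (G' x) (n * τ) with hR
  set D : ℕ → ℝ → ℂ := fun n => iteratedDerivWithin 2 (fun y => P y (n * τ)) (Set.Icc 0 l) with hD
  have hYn : 0 ≤ Y0 * (τ + h ^ 4) := by positivity
  have key := FeynmanKac.grid_stability h0 h1 (δ := K * τ ^ α / h ^ 2) (by positivity)
    (N := N) hM (e := e) (r := fun n i => (R n (i * h + h) + 10 * R n (i * h) + R n (i * h - h)) / 12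
          + (K * τ ^ α : ℝ) * Complex.exp (ρ * (n * τ : ℝ)) *
            ((D n (i * h + h) + 10 * D n (i * h) + D n (i * h - h)) / 12
            - (P (i * h + h) (n * τ) - 2 * P (i * h) (n * τ) + P (i * h - h) (n * τ))
              / (h : ℂ) ^ 2)) hYn ?_ ?_ ?_ ?_ ?_
  · have hge : 0 ≤ τ + h ^ 4 := by positivity
    refine FeynmanKac.maxNorm_le (by positivity) fun i hi1 hiM => ?_
    have hk := key n hn i (by omega)
    simp only [he] at hk
    rw [norm_mul, Complex.norm_exp, Complex.re_mul_ofReal] at hk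
    have h2 : 1 ≤ Real.exp (ρ.re * (n * τ)) := Real.one_le_exp (by positivity)
    calc ‖P (i * h) (n * τ) - Q n i‖
        ≤ Real.exp (ρ.re * (n * τ)) * ‖P (i * h) (n * τ) - Q n i‖ :=
          le_mul_of_one_le_left (norm_nonneg _) h2
      _ ≤ FeynmanKac.kernelBound * (Y0 * (τ + h ^ 4)) := hk
      _ ≤ _ := by
          rw [← mul_assoc]
          gcongr
          linarith
  · intro i hi
    simp only [he]
    rw [hQ0 i hi]
    simp
  · intro n hn
    simp only [he]
    rcases Nat.eq_zero_or_pos n with rfl | hpos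
    · rw [hQ0 0 (by omega)]
      simp
    · rw [hQ.boundary_left n (Finset.mem_Icc.2 ⟨hpos, hn⟩), Nat.cast_zero, zero_mul,
        hP.boundary_left _ (htmem n hpos hn), sub_self, mul_zero]
  · intro n hn
    simp only [he]
    rcases Nat.eq_zero_or_pos n with rfl | hpos
    · rw [hQ0 M le_rfl]
      simp
    · rw [hQ.boundary_right n (Finset.mem_Icc.2 ⟨hpos, hn⟩), hMh,
        hP.boundary_right _ (htmem n hpos hn), sub_self, mul_zero]
  · intro n hn1 hnN i hi1 hiM
    exact FeynmanKac.error_equation hQ hQ0 hn1 hnN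
      (V := fun x => FeynmanKac.fracInt α (G' x) (n * τ)) (D := D n)
      (fun j hj => FeynmanKac.source_eq hl h1 hf hP hreg hGc (fun x hx => (hG x hx).1)
        (fun x hx => (hG x hx).2.1) (htmem n hn1 hnN) _ (hxmem j hj))
      hi1 hiM (fun _ _ => rfl) (fun _ => rfl)
  · intro n hn1 hnN i hi1 hiM
    have hn0 : (0 : ℝ) < n := by exact_mod_cast hn1
    have ht := htmem n hn1 hnN
    set X := (n : ℝ) ^ (-α) with hX
    have hX0 : 0 < X := by positivity
    have hRb : ∀ x ∈ Set.Icc 0 l, ‖R n x‖ ≤ C3 * (τ * X) := fun x hx => by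
      obtain ⟨g1, g2, g3⟩ := hG x hx
      have hcx : ContinuousOn (G' x) (Set.Icc 0 T) :=
        hGc.comp (f := fun t => (x, t)) (by fun_prop) fun s hs => ⟨hx, hs⟩
      exact FeynmanKac.grunwald_truncation h0 h1 (by simp) g1 g2 g3 hC0 hcx hτ0 hn1 ht.2
    have x1 : (i : ℝ) * h + h = ((i + 1 : ℕ) : ℝ) * h := by
      push_cast
      ring
    have x2 : (i : ℝ) * h - h = ((i - 1 : ℕ) : ℝ) * h := by
      push_cast [Nat.cast_sub hi1]
      ring
    have m0 := hxmem i (by omega)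
    have m1 : (i : ℝ) * h + h ∈ Set.Icc 0 l := x1 ▸ hxmem (i + 1) (by omega)
    have m2 : (i : ℝ) * h - h ∈ Set.Icc 0 l := x2 ▸ hxmem (i - 1) (by omega)
    have hsp := FeynmanKac.compact_truncation (a := 0) (b := l) (C := S) (h := h) (x := i * h)
      (fun j => iteratedDerivWithin j (fun y => P y (n * τ)) (Set.Icc 0 l))
      (fun k hk x hx => FeynmanKac.hasDerivWithinAt_iteratedDerivWithin hl
        (hreg.contDiff_x _ ⟨ht.1.le, ht.2⟩) hk hx)
      (fun x hx => hS x hx _ ⟨ht.1.le, ht.2⟩) hh0 m2.1 m1.2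
    simp only [iteratedDerivWithin_zero] at hsp
    -- Writing `τ^α = t_n^α n^(-α)` gives the space residual the same weight `n^(-α)` as the time
    -- residual.
    have hτα : τ ^ α ≤ T ^ α * X := by
      have : τ ^ α = (n * τ) ^ α * X := by
        rw [Real.mul_rpow hn0.le hτ0.le, mul_right_comm, hX, ← Real.rpow_add hn0]
        simp
      rw [this]
      have := ht.1
      have := ht.2
      gcongr
    have b1 : ‖(R n (i * h + h) + 10 * R n (i * h) + R n (i * h - h)) / 12‖ ≤ C3 * (τ * X) := by
      rw [norm_div]
      have n1 := hRb _ m1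
      have n2 := hRb _ m0
      have n3 := hRb _ m2
      have : ‖R n (i * h + h) + 10 * R n (i * h) + R n (i * h - h)‖ ≤ 12 * (C3 * (τ * X)) := by
        refine (norm_add₃_le).trans ?_
        rw [norm_mul]
        norm_num
        linarith
      rw [Complex.norm_ofNat, div_le_iff₀ (by norm_num)]
      linarith
    have b2 : ‖((K * τ ^ α : ℝ) : ℂ) * Complex.exp (ρ * (n * τ : ℝ)) *
        ((D n (i * h + h) + 10 * D n (i * h) + D n (i * h - h)) / 12
          - (P (i * h + h) (n * τ) - 2 * P (i * h) (n * τ) + P (i * h - h) (n * τ))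
            / (h : ℂ) ^ 2)‖ ≤ K * (T ^ α * X) * Real.exp (ρ.re * T) * (69 * S * h ^ 4) := by
      rw [norm_mul, norm_mul, Complex.norm_real, Real.norm_of_nonneg (by positivity),
        Complex.norm_exp, Complex.re_mul_ofReal]
      have := ht.2
      have hD' := hsp
      gcongr
    have hA := FeynmanKac.le_coeffSum h0 h1 hn1
    refine (norm_add_le _ _).trans ((add_le_add b1 b2).trans ?_)
    calc C3 * (τ * X) + K * (T ^ α * X) * Real.exp (ρ.re * T) * (69 * S * h ^ 4)
        = (C3 * τ + K * T ^ α * Real.exp (ρ.re * T) * (69 * S) * h ^ 4) * X := by ring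
      _ ≤ (C4 * (τ + h ^ 4)) * X := by
          refine mul_le_mul_of_nonneg_right ?_ hX0.le
          rw [hC4]
          have p1 : 0 ≤ K * T ^ α * Real.exp (ρ.re * T) * (69 * S) * τ := by positivity
          have p2 : 0 ≤ C3 * h ^ 4 := by positivity
          linarith
      _ = ((1 - α) / Real.Gamma (1 - α) * X) * (Y0 * (τ + h ^ 4)) := by
          rw [hY0]
          field_simp
      _ ≤ _ := by gcongr
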